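/- Let $(M,\xi,\eta,\phi,g)$ be a Sasakian 3-manifold: $(M,g)$ is a smooth Riemannian 3-manifold (without boundary), $\eta$ is a smooth contact form ($\eta\wedge d\eta\neq 0$ everywhere), $\xi$ is its Reeb field ($\eta(\xi)=1$, $d\eta(\xi,\cdot)=0$), $\phi$ is a smooth $(1,1)$-tensor field with $\phi^2=-I+\eta\otimes\xi$, one has $\tfrac12 d\eta(\cdot,\cdot)=g(\cdot,\phi(\cdot))$ and $\eta(\cdot)=g(\cdot,\xi)$, and $\xi$ is a Killing field of $g$. (Here $d\eta(X,Y)=X\eta(Y)-Y\eta(X)-\eta([X,Y])$.) Let $\psi:M\to\mathbb{R}$ be an isoparametric function, i.e. a smooth function for which there are functions $\mathcal F_1,\mathcal F_2:\mathbb{R}\to\mathbb{R}$ with $$|\mathrm{grad}\,\psi|^2=\mathcal F_1(\psi),\qquad \Delta\psi=\mathcal F_2(\psi)\qquad(\Delta=-\mathrm{div}\,\mathrm{grad}),$$ and assume that $\xi(\psi)=0$. Then for all smooth functions $F,G:\mathbb{R}\to\mathbb{R}$ the vector field $$u=F(\psi)\,\xi+\phi\big(\mathrm{grad}\,(G(\psi))\big)$$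 is a localizable steady Euler field on $(M,g)$. That is, $u$ is smooth, $\mathrm{div}\,u=0$, there is a smooth function $p:M\to\mathbb{R}$ with $\nabla_u u=-\mathrm{grad}\,p$ ($\nabla$ the Levi-Civita connection), and $u(|u|^2)=0$ everywhere on $M$. -/

import Mathlib

open Bundle VectorField
open scoped Manifold ContDiff InnerProductSpace Topology

noncomputable section

set_option linter.unusedSectionVars false

namespace SasakianEuler

section Riemannian

variable {E : Type*} [NormedAddCommGroup E] [NormedSpace ℝ E] [FiniteDimensional ℝ E]
  {H : Type*} [TopologicalSpace H] (I : ModelWithCorners ℝ E H)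
  {M : Type*} [TopologicalSpace M] [ChartedSpace H M]
  [RiemannianBundle (fun x : M => TangentSpace I x)]

/-- Half the right-hand side of the Koszul formula: the value at `x` of
`½ (X g(Y,Z) + Y g(X,Z) - Z g(X,Y) + g([X,Y],Z) - g([X,Z],Y) - g([Y,Z],X))`. -/
def koszul (X Y Z : Π x : M, TangentSpace I x) (x : M) : ℝ :=
  (1 / 2) *
    (d% (fun y => ⟪Y y, Z y⟫_ℝ) x (X x) + d% (fun y => ⟪X y, Z y⟫_ℝ) x (Y x)
      - d% (fun y => ⟪X y, Y y⟫_ℝ) x (Z x)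
      + ⟪mlieBracket I X Y x, Z x⟫_ℝ - ⟪mlieBracket I X Z x, Y x⟫_ℝ
      - ⟪mlieBracket I Y Z x, X x⟫_ℝ)

variable {I} in
theorem mvfderiv_inner_comm (X Y : Π x : M, TangentSpace I x) (x : M) :
    d% (fun y => ⟪X y, Y y⟫_ℝ) x = d% (fun y => ⟪Y y, X y⟫_ℝ) x := by
  simp only [real_inner_comm]

variable [IsManifold I ∞ M]
  [IsContMDiffRiemannianBundle I ∞ E (fun x : M => TangentSpace I x)]

variable {I} in
theorem mdifferentiableAt_inner {X Y : Π x : M, TangentSpace I x} {x : M}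
    (hX : MDiffAt (T% X) x) (hY : MDiffAt (T% Y) x) : MDiffAt (fun y => ⟪X y, Y y⟫_ℝ) x :=
  MDifferentiableAt.inner_bundle (E := fun x : M => TangentSpace I x) (b := fun y => y) hX hY

variable {I} in
theorem mvfderiv_inner_smul_left {f : M → ℝ} {X Y : Π x : M, TangentSpace I x} {x : M}
    (hf : MDiffAt f x) (hX : MDiffAt (T% X) x) (hY : MDiffAt (T% Y) x) (v : TangentSpace I x) :
    d% (fun y => ⟪(f • X) y, Y y⟫_ℝ) x v
      = f x * d% (fun y => ⟪X y, Y y⟫_ℝ) x v + d% f x v * ⟪X x, Y x⟫_ℝ := by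
  have h1 : (fun y => ⟪(f • X) y, Y y⟫_ℝ) = fun y => f y * ⟪X y, Y y⟫_ℝ := by
    ext y; simp [inner_smul_left]
  rw [h1, mvfderiv_fun_mul hf (mdifferentiableAt_inner hX hY)]
  simp
  ring

variable {I} in
theorem mvfderiv_inner_add_left {X X' Y : Π x : M, TangentSpace I x} {x : M}
    (hX : MDiffAt (T% X) x) (hX' : MDiffAt (T% X') x) (hY : MDiffAt (T% Y) x)
    (v : TangentSpace I x) :
    d% (fun y => ⟪(X + X') y, Y y⟫_ℝ) x v
      = d% (fun y => ⟪X y, Y y⟫_ℝ) x v + d% (fun y => ⟪X' y, Y y⟫_ℝ) x v := by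
  have h1 : (fun y => ⟪(X + X') y, Y y⟫_ℝ) = fun y => ⟪X y, Y y⟫_ℝ + ⟪X' y, Y y⟫_ℝ := by
    ext y; simp [inner_add_left]
  rw [h1, mvfderiv_fun_add (mdifferentiableAt_inner hX hY) (mdifferentiableAt_inner hX' hY)]
  simp

theorem koszul_smul_left {f : M → ℝ} {X Y Z : Π x : M, TangentSpace I x} {x : M}
    (hf : MDiffAt f x) (hX : MDiffAt (T% X) x) (hY : MDiffAt (T% Y) x) (hZ : MDiffAt (T% Z) x) :
    koszul I (f • X) Y Z x = f x * koszul I X Y Z x := by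
  simp only [koszul, mvfderiv_inner_smul_left hf hX hY, mvfderiv_inner_smul_left hf hX hZ,
    mlieBracket_smul_left hf hX]
  simp [inner_add_left, inner_smul_left, inner_smul_right, real_inner_comm]
  ring

theorem koszul_smul_mid {f : M → ℝ} {X Y Z : Π x : M, TangentSpace I x} {x : M}
    (hf : MDiffAt f x) (hX : MDiffAt (T% X) x) (hY : MDiffAt (T% Y) x) (hZ : MDiffAt (T% Z) x) :
    koszul I X (f • Y) Z x = f x * koszul I X Y Z x + d% f x (X x) * ⟪Y x, Z x⟫_ℝ := by
  rw [koszul, koszul, mvfderiv_inner_comm X (f • Y), mvfderiv_inner_comm X Y]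
  simp only [mvfderiv_inner_smul_left hf hY hX, mvfderiv_inner_smul_left hf hY hZ, mlieBracket_smul_left hf hY, mlieBracket_smul_right hf hY]
  simp [inner_add_left, inner_smul_left, inner_smul_right]
  rw [real_inner_comm (X x) (Y x)]
  ring

theorem koszul_smul_right {f : M → ℝ} {X Y Z : Π x : M, TangentSpace I x} {x : M}
    (hf : MDiffAt f x) (hX : MDiffAt (T% X) x) (hY : MDiffAt (T% Y) x) (hZ : MDiffAt (T% Z) x) :
    koszul I X Y (f • Z) x = f x * koszul I X Y Z x := by
  rw [koszul, koszul, mvfderiv_inner_comm X (f • Z), mvfderiv_inner_comm Y (f • Z),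
    mvfderiv_inner_comm X Z, mvfderiv_inner_comm Y Z]
  simp only [mvfderiv_inner_smul_left hf hZ hX, mvfderiv_inner_smul_left hf hZ hY,
    mlieBracket_smul_right hf hZ]
  simp [inner_add_left, inner_smul_left, inner_smul_right]
  ring

theorem koszul_add_left {X X' Y Z : Π x : M, TangentSpace I x} {x : M}
    (hX : MDiffAt (T% X) x) (hX' : MDiffAt (T% X') x)
    (hY : MDiffAt (T% Y) x) (hZ : MDiffAt (T% Z) x) :
    koszul I (X + X') Y Z x = koszul I X Y Z x + koszul I X' Y Z x := by
  simp only [koszul, mvfderiv_inner_add_left hX hX' hY, mvfderiv_inner_add_left hX hX' hZ,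
    mlieBracket_add_left hX hX']
  simp [inner_add_left, inner_add_right]
  ring

theorem koszul_add_mid {X Y Y' Z : Π x : M, TangentSpace I x} {x : M}
    (hX : MDiffAt (T% X) x) (hY : MDiffAt (T% Y) x)
    (hY' : MDiffAt (T% Y') x) (hZ : MDiffAt (T% Z) x) :
    koszul I X (Y + Y') Z x = koszul I X Y Z x + koszul I X Y' Z x := by
  simp only [koszul, mvfderiv_inner_comm X, mvfderiv_inner_add_left hY hY' hX,
    mvfderiv_inner_add_left hY hY' hZ, mlieBracket_add_left hY hY', mlieBracket_add_right hY hY']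
  simp [inner_add_left, inner_add_right]
  ring

theorem koszul_add_right {X Y Z Z' : Π x : M, TangentSpace I x} {x : M}
    (hX : MDiffAt (T% X) x) (hY : MDiffAt (T% Y) x)
    (hZ : MDiffAt (T% Z) x) (hZ' : MDiffAt (T% Z') x) :
    koszul I X Y (Z + Z') x = koszul I X Y Z x + koszul I X Y Z' x := by
  rw [koszul, koszul, koszul, mvfderiv_inner_comm X (Z + Z'), mvfderiv_inner_comm Y (Z + Z'),
    mvfderiv_inner_comm X Z, mvfderiv_inner_comm Y Z, mvfderiv_inner_comm X Z',
    mvfderiv_inner_comm Y Z']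
  simp only [mvfderiv_inner_add_left hZ hZ' hX, mvfderiv_inner_add_left hZ hZ' hY,
    mlieBracket_add_right hZ hZ']
  simp [inner_add_left, inner_add_right]
  ring

/-- The Koszul form `(v, w) ↦ g(∇_v Y, w)` at `x`, for `Y` differentiable at `x`. -/
def koszulForm (Y : Π x : M, TangentSpace I x) (x : M) (hY : MDiffAt (T% Y) x) :
    TangentSpace I x →L[ℝ] TangentSpace I x →L[ℝ] ℝ :=
  TensorialAt.mkHom₂ (I := I) (F := E) (F' := E) (fun X Z => koszul I X Y Z x) x
    (fun _ hZ => ⟨fun hf hX => koszul_smul_left I hf hX hY hZ,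
      fun hX hX' => koszul_add_left I hX hX' hY hZ⟩)
    (fun _ hX => ⟨fun hf hZ => koszul_smul_right I hf hX hY hZ,
      fun hZ hZ' => koszul_add_right I hX hY hZ hZ'⟩)

theorem koszulForm_apply {X Y Z : Π x : M, TangentSpace I x} {x : M}
    (hX : MDiffAt (T% X) x) (hY : MDiffAt (T% Y) x) (hZ : MDiffAt (T% Z) x) :
    koszulForm I Y x hY (X x) (Z x) = koszul I X Y Z x :=
  TensorialAt.mkHom₂_apply _ _ hX hZ

instance (x : M) : FiniteDimensional ℝ (TangentSpace I x) :=
  inferInstanceAs (FiniteDimensional ℝ E)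

instance (x : M) : CompleteSpace (TangentSpace I x) := FiniteDimensional.complete ℝ _

open Classical in
/-- The function underlying the Levi-Civita connection: `leviCivitaFun I Y x v = (∇_v Y)(x)` is the
vector dual to the Koszul form of `Y` (and `0` where `Y` is not differentiable). -/
def leviCivitaFun (Y : Π x : M, TangentSpace I x) (x : M) :
    TangentSpace I x →L[ℝ] TangentSpace I x :=
  if hY : MDiffAt (T% Y) x then
    LinearMap.toContinuousLinearMap
      { toFun := fun v => (InnerProductSpace.toDual ℝ (TangentSpace I x)).symm
          (koszulForm I Y x hY v)
        map_add' := fun v w => by simp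
        map_smul' := fun c v => by simp }
  else 0

theorem inner_leviCivitaFun {X Y Z : Π x : M, TangentSpace I x} {x : M}
    (hX : MDiffAt (T% X) x) (hY : MDiffAt (T% Y) x) (hZ : MDiffAt (T% Z) x) :
    ⟪leviCivitaFun I Y x (X x), Z x⟫_ℝ = koszul I X Y Z x := by
  rw [leviCivitaFun, dif_pos hY, ← koszulForm_apply I hX hY hZ]
  exact InnerProductSpace.toDual_symm_apply (𝕜 := ℝ) (E := TangentSpace I x)

theorem leviCivitaFun_ext {x : M} {A B : TangentSpace I x →L[ℝ] TangentSpace I x}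
    (h : ∀ X Z : Π x : M, TangentSpace I x, MDiffAt (T% X) x → MDiffAt (T% Z) x →
      ⟪A (X x), Z x⟫_ℝ = ⟪B (X x), Z x⟫_ℝ) : A = B := by
  ext v
  refine ext_inner_right ℝ fun w => ?_
  have := h (FiberBundle.extend E v) (FiberBundle.extend E w)
    (FiberBundle.mdifferentiableAt_extend I E v) (FiberBundle.mdifferentiableAt_extend I E w)
  simpa using this

/-- The Levi-Civita connection of the Riemannian metric. -/
def leviCivita : CovariantDerivative I E (fun x : M => TangentSpace I x) where
  toFun := leviCivitaFun I
  isCovariantDerivativeOnUniv :=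
    { add := by
        intro Y Y' x hY hY' _
        refine leviCivitaFun_ext I fun X Z hX hZ => ?_
        rw [inner_leviCivitaFun I hX (mdifferentiableAt_add_section hY hY') hZ,
          koszul_add_mid I hX hY hY' hZ, add_apply, inner_add_left,
          inner_leviCivitaFun I hX hY hZ, inner_leviCivitaFun I hX hY' hZ]
      leibniz := by
        intro Y f x hY hf _
        refine leviCivitaFun_ext I fun X Z hX hZ => ?_
        rw [inner_leviCivitaFun I hX (hf.smul_section hY) hZ, koszul_smul_mid I hf hX hY hZ]
        simp [inner_add_left, inner_smul_left, inner_leviCivitaFun I hX hY hZ] }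

theorem inner_leviCivita {X Y Z : Π x : M, TangentSpace I x} {x : M}
    (hX : MDiffAt (T% X) x) (hY : MDiffAt (T% Y) x) (hZ : MDiffAt (T% Z) x) :
    ⟪leviCivita I Y x (X x), Z x⟫_ℝ = koszul I X Y Z x :=
  inner_leviCivitaFun I hX hY hZ

theorem leviCivita_isMetricCompatible :
    CovariantDerivative.IsMetricCompatible (V := fun x : M => TangentSpace I x) (leviCivita I) := by
  rw [CovariantDerivative.isMetricCompatible_iff]
  intro x X Y Z hX hY hZ
  change _ = ⟪leviCivita I Y x (X x), Z x⟫_ℝ + ⟪Y x, leviCivita I Z x (X x)⟫_ℝ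
  rw [real_inner_comm (leviCivita I Z x (X x)), inner_leviCivita I hX hY hZ, inner_leviCivita I hX hZ hY]
  simp only [koszul]
  rw [mvfderiv_inner_comm Z Y, mlieBracket_swap (V := Z) (W := Y)]
  simp
  ring

theorem leviCivita_torsion : (leviCivita I (M := M)).torsion = 0 := by
  rw [CovariantDerivative.torsion_eq_zero_iff]
  intro X Y x hX hY
  refine ext_inner_right ℝ fun w => ?_
  have hZ := FiberBundle.mdifferentiableAt_extend I E w
  rw [← FiberBundle.extend_apply_self (F := E) w, inner_sub_left, inner_leviCivita I hX hY hZ,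
    inner_leviCivita I hY hX hZ]
  simp only [koszul]
  rw [mvfderiv_inner_comm Y X, mlieBracket_swap (V := Y) (W := X)]
  simp
  ring

/-- The gradient of a function: `g(grad f, v) = df(v)`. -/
def grad (f : M → ℝ) (x : M) : TangentSpace I x :=
  (InnerProductSpace.toDual ℝ (TangentSpace I x)).symm (d% f x)

/-- The divergence of a vector field: the trace of `v ↦ ∇_v X`. -/
def divergence (X : Π x : M, TangentSpace I x) (x : M) : ℝ :=
  LinearMap.trace ℝ (TangentSpace I x) (leviCivita I X x).toLinearMap

/-- The Laplacian with the geometers' sign: `Δ f = - div (grad f)`. -/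
def laplacian (f : M → ℝ) (x : M) : ℝ := - divergence I (grad I f) x

/-- `ψ` is isoparametric: smooth, and both `|grad ψ|²` and `Δ ψ` are functions of `ψ`. -/
def IsIsoparametric (ψ : M → ℝ) : Prop :=
  CMDiff ∞ ψ ∧ ∃ F₁ F₂ : ℝ → ℝ,
    ∀ x, ⟪grad I ψ x, grad I ψ x⟫_ℝ = F₁ (ψ x) ∧ laplacian I ψ x = F₂ (ψ x)

/-- A steady Euler field: a smooth vector field `u` with `∇_u u = - grad p` for some smooth
pressure function `p`, and `div u = 0`. -/
def IsSteadyEuler (u : Π x : M, TangentSpace I x) : Prop :=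
  CMDiff ∞ (T% u) ∧
  (∃ p : M → ℝ, CMDiff ∞ p ∧ ∀ x, leviCivita I u x (u x) = - grad I p x) ∧
  ∀ x, divergence I u x = 0

/-- A steady Euler field is localizable if its norm is conserved along its flow: `u(|u|²) = 0`. -/
def IsLocalizable (u : Π x : M, TangentSpace I x) : Prop :=
  IsSteadyEuler I u ∧ ∀ x, d% (fun y => ⟪u y, u y⟫_ℝ) x (u x) = 0

/-- A Killing field: a smooth vector field `ξ` with `L_ξ g = 0`, that is
`ξ(g(X,Y)) = g([ξ,X],Y) + g(X,[ξ,Y])` for all (locally defined) smooth vector fields `X`, `Y`. -/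
def IsKilling (ξ : Π x : M, TangentSpace I x) : Prop :=
  CMDiff ∞ (T% ξ) ∧
  ∀ (x : M) (X Y : Π y : M, TangentSpace I y), CMDiffAt ∞ (T% X) x → CMDiffAt ∞ (T% Y) x →
    d% (fun y => ⟪X y, Y y⟫_ℝ) x (ξ x)
      = ⟪mlieBracket I ξ X x, Y x⟫_ℝ + ⟪X x, mlieBracket I ξ Y x⟫_ℝ

end Riemannian

section Forms

variable {E : Type*} [NormedAddCommGroup E] [NormedSpace ℝ E] [FiniteDimensional ℝ E]
  {H : Type*} [TopologicalSpace H] (I : ModelWithCorners ℝ E H)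
  {M : Type*} [TopologicalSpace M] [ChartedSpace H M] [IsManifold I ∞ M]

/-- A 1-form is smooth if it is a smooth section of the cotangent bundle. -/
def IsSmoothOneForm (η : Π x : M, TangentSpace I x →L[ℝ] ℝ) : Prop :=
  ContMDiff I (I.prod 𝓘(ℝ, E →L[ℝ] ℝ)) ∞
    (fun x => TotalSpace.mk' (E →L[ℝ] ℝ) (E := fun x : M => TangentSpace I x →L[ℝ] ℝ) x (η x))

/-- A `(1,1)`-tensor field is smooth if it is a smooth section of the bundle of endomorphisms. -/
def IsSmoothEndomorphism (φ : Π x : M, TangentSpace I x →L[ℝ] TangentSpace I x) : Prop :=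
  ContMDiff I (I.prod 𝓘(ℝ, E →L[ℝ] E)) ∞
    (fun x => TotalSpace.mk' (E →L[ℝ] E)
      (E := fun x : M => TangentSpace I x →L[ℝ] TangentSpace I x) x (φ x))

/-- `dη(X,Y) = X(η(Y)) - Y(η(X)) - η([X,Y])` for vector fields `X`, `Y`. -/
def extDerivFields (η : Π x : M, TangentSpace I x →L[ℝ] ℝ) (X Y : Π x : M, TangentSpace I x)
    (x : M) : ℝ :=
  d% (fun y => η y (Y y)) x (X x) - d% (fun y => η y (X y)) x (Y x) - η x (mlieBracket I X Y x)

theorem mdifferentiableAt_oneForm_apply {η : Π x : M, TangentSpace I x →L[ℝ] ℝ}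
    (hη : IsSmoothOneForm I η) {X : Π x : M, TangentSpace I x} {x : M}
    (hX : MDiffAt (T% X) x) : MDiffAt (fun y => η y (X y)) x := by
  have h : MDifferentiableAt I (I.prod 𝓘(ℝ))
      (fun m => TotalSpace.mk' ℝ (E := Bundle.Trivial M ℝ) m (η m (X m))) x :=
    MDifferentiableAt.clm_bundle_apply (F₁ := E) (E₁ := fun x : M => TangentSpace I x)
      (b := fun y => y) ((hη x).mdifferentiableAt (by simp)) hX
  simp only [mdifferentiableAt_totalSpace] at h
  exact h.2

theorem extDerivFields_swap (η : Π x : M, TangentSpace I x →L[ℝ] ℝ)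
    (X Y : Π x : M, TangentSpace I x) (x : M) :
    extDerivFields I η X Y x = - extDerivFields I η Y X x := by
  simp only [extDerivFields]
  rw [mlieBracket_swap]
  simp
  ring

theorem extDerivFields_tensorial {η : Π x : M, TangentSpace I x →L[ℝ] ℝ}
    (hη : IsSmoothOneForm I η) {Y : Π x : M, TangentSpace I x} {x : M} (hY : MDiffAt (T% Y) x) :
    TensorialAt I E (fun X => extDerivFields I η X Y x) x where
  smul {f X} hf hX := by
    have h : (fun y => η y ((f • X) y)) = fun y => f y * η y (X y) := by ext y; simp
    simp only [extDerivFields, h, mlieBracket_smul_left hf hX,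
      mvfderiv_fun_mul hf (mdifferentiableAt_oneForm_apply I hη hX)]
    simp
    ring
  add {X X'} hX hX' := by
    have h : (fun y => η y ((X + X') y)) = fun y => η y (X y) + η y (X' y) := by ext y; simp
    simp only [extDerivFields, h, mlieBracket_add_left hX hX',
      mvfderiv_fun_add (mdifferentiableAt_oneForm_apply I hη hX)
        (mdifferentiableAt_oneForm_apply I hη hX')]
    simp
    ring

/-- The exterior derivative of a smooth 1-form, as a bilinear form on each tangent space. -/
def extDeriv (η : Π x : M, TangentSpace I x →L[ℝ] ℝ) (hη : IsSmoothOneForm I η) (x : M) :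
    TangentSpace I x →L[ℝ] TangentSpace I x →L[ℝ] ℝ :=
  TensorialAt.mkHom₂ (I := I) (F := E) (F' := E) (fun X Y => extDerivFields I η X Y x) x
    (fun _ h => extDerivFields_tensorial I hη h)
    (fun X hX =>
      ⟨fun hf hY => by
        simp only [extDerivFields_swap I η X, (extDerivFields_tensorial I hη hX).smul hf hY,
          smul_neg],
      fun {Y Y'} hY hY' => by
        simp only [extDerivFields_swap I η X, (extDerivFields_tensorial I hη hX).add hY hY',
          neg_add]⟩)

theorem extDeriv_apply {η : Π x : M, TangentSpace I x →L[ℝ] ℝ} (hη : IsSmoothOneForm I η)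
    {X Y : Π x : M, TangentSpace I x} {x : M} (hX : MDiffAt (T% X) x) (hY : MDiffAt (T% Y) x) :
    extDeriv I η hη x (X x) (Y x) =
      d% (fun y => η y (Y y)) x (X x) - d% (fun y => η y (X y)) x (Y x)
        - η x (mlieBracket I X Y x) :=
  TensorialAt.mkHom₂_apply _ _ hX hY

end Forms

/-- A Sasakian structure `(ξ, η, φ, g)` on a Riemannian 3-manifold `(M, g)`. -/
structure SasakianStructure (M : Type*) [TopologicalSpace M]
    [ChartedSpace (EuclideanSpace ℝ (Fin 3)) M] [IsManifold (𝓡 3) ∞ M]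
    [RiemannianBundle (fun x : M => TangentSpace (𝓡 3) x)]
    [IsContMDiffRiemannianBundle (𝓡 3) ∞ (EuclideanSpace ℝ (Fin 3))
      (fun x : M => TangentSpace (𝓡 3) x)] where
  /-- The Reeb vector field. -/
  ξ : Π x : M, TangentSpace (𝓡 3) x
  /-- The contact form. -/
  η : Π x : M, TangentSpace (𝓡 3) x →L[ℝ] ℝ
  /-- The transverse complex structure. -/
  φ : Π x : M, TangentSpace (𝓡 3) x →L[ℝ] TangentSpace (𝓡 3) x
  smooth_η : IsSmoothOneForm (𝓡 3) η
  smooth_φ : IsSmoothEndomorphism (𝓡 3) φ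
  /-- The 3-form `η ∧ dη` vanishes nowhere. -/
  contact : ∀ x, ∃ a b c : TangentSpace (𝓡 3) x,
    η x a * extDeriv (𝓡 3) η smooth_η x b c + η x b * extDeriv (𝓡 3) η smooth_η x c a
      + η x c * extDeriv (𝓡 3) η smooth_η x a b ≠ 0
  η_ξ : ∀ x, η x (ξ x) = 1
  dη_ξ : ∀ x v, extDeriv (𝓡 3) η smooth_η x (ξ x) v = 0
  φ_sq : ∀ x v, φ x (φ x v) = - v + η x v • ξ x
  half_dη : ∀ x v w, (1 / 2 : ℝ) * extDeriv (𝓡 3) η smooth_η x v w = ⟪v, φ x w⟫_ℝ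
  η_eq : ∀ x v, η x v = ⟪v, ξ x⟫_ℝ
  killing : IsKilling (𝓡 3) ξ

end SasakianEuler

end

noncomputable section

set_option linter.unusedSectionVars false

namespace SasakianEuler

section Derivations

variable {E : Type*} [NormedAddCommGroup E] [NormedSpace ℝ E] [FiniteDimensional ℝ E]
  {H : Type*} [TopologicalSpace H] {I : ModelWithCorners ℝ E H}
  {M : Type*} [TopologicalSpace M] [ChartedSpace H M] [IsManifold I ∞ M]

theorem two_le_infty : (2 : WithTop ℕ∞) ≤ ∞ := ENat.LEInfty.out

theorem contMDiffAt_mvfderiv_apply {f : M → ℝ} {X : Π x : M, TangentSpace I x} {x : M}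
    (hf : CMDiffAt ∞ f x) (hX : CMDiffAt ∞ (T% X) x) :
    CMDiffAt ∞ (fun y => d% f y (X y)) x := by
  have h := ContMDiffAt.clm_apply_of_inCoordinates (b₁ := fun y : M => y) (b₂ := f)
    (E₁ := fun x : M => TangentSpace I x) (E₂ := fun x : ℝ => TangentSpace 𝓘(ℝ, ℝ) x)
    (ϕ := fun y => mfderiv% f y) (v := X) (hf.mfderiv_const (m := ∞) (by simp)) hX hf
  rw [contMDiffAt_totalSpace] at h
  replace h := h.2
  simp only [id] at h
  simp at h
  exact h

theorem contMDiffAt_mlieBracket {X Y : Π x : M, TangentSpace I x} {x : M}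
    (hX : CMDiffAt ∞ (T% X) x) (hY : CMDiffAt ∞ (T% Y) x) :
    CMDiffAt ∞ (T% (mlieBracket I X Y)) x := by
  have : IsManifold I ((⊤ : ℕ∞) + 1) M := by simpa using ‹IsManifold I ∞ M›
  have : IsManifold I (minSmoothness ℝ 2) M := by
    simpa using IsManifold.of_le (n := ∞) two_le_infty
  exact ContMDiffAt.mlieBracket_vectorField (m := ⊤) (n := ⊤) hX hY (by simp)

theorem eventually_mdifferentiableAt_section {X : Π x : M, TangentSpace I x} {x : M}
    (hX : CMDiffAt ∞ (T% X) x) : ∀ᶠ y in 𝓝 x, MDiffAt (T% X) y := by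
  filter_upwards [(contMDiffAt_iff_contMDiffAt_nhds (n := 1) (by simp)).1 (hX.of_le (by simp))]
    with y hy
  exact hy.mdifferentiableAt (by simp)

theorem eventually_mdifferentiableAt_function {f : M → ℝ} {x : M}
    (hf : CMDiffAt ∞ f x) : ∀ᶠ y in 𝓝 x, MDiffAt f y := by
  filter_upwards [(contMDiffAt_iff_contMDiffAt_nhds (n := 1) (by simp)).1 (hf.of_le (by simp))]
    with y hy
  exact hy.mdifferentiableAt (by simp)

/-- The Lie bracket acts on functions as the commutator of derivations. -/
theorem mvfderiv_mlieBracket {f : M → ℝ} {U V : Π x : M, TangentSpace I x} {x : M}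
    (hf : CMDiffAt ∞ f x) (hU : CMDiffAt ∞ (T% U) x) (hV : CMDiffAt ∞ (T% V) x) :
    d% f x (mlieBracket I U V x)
      = d% (fun y => d% f y (V y)) x (U x) - d% (fun y => d% f y (U y)) x (V x) := by
  by_cases hE : Subsingleton E
  · have h0 (v : TangentSpace I x) : v = 0 := Subsingleton.elim (α := E) v 0
    rw [h0 (mlieBracket I U V x), h0 (U x), h0 (V x)]
    simp
  rw [not_subsingleton_iff_nontrivial] at hE
  obtain ⟨z, hz⟩ := exists_ne (0 : E)
  let Z : Π x : M, TangentSpace I x := FiberBundle.extend E (x := x) z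
  have hZ : CMDiffAt ∞ (T% Z) x := FiberBundle.contMDiffAt_extend I E _
  have hZx : Z x = z :=
    FiberBundle.extend_apply_self (F := E) (E := fun x : M => TangentSpace I x) (x := x) z
  have hfZ : CMDiffAt ∞ (T% (f • Z)) x := hf.smul_section hZ
  have md {X : Π x : M, TangentSpace I x} (hX : CMDiffAt ∞ (T% X) x) : MDiffAt (T% X) x :=
    hX.mdifferentiableAt (by simp)
  have step {W : Π x : M, TangentSpace I x} :
      mlieBracket I W (f • Z) =ᶠ[𝓝 x]
        (fun y => d% f y (W y)) • Z + f • mlieBracket I W Z := by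
    filter_upwards [eventually_mdifferentiableAt_section hZ,
      eventually_mdifferentiableAt_function hf] with y hZy hfy
    rw [mlieBracket_smul_right hfy hZy]
    rfl
  have outer {W W' : Π x : M, TangentSpace I x} (hW : CMDiffAt ∞ (T% W) x)
      (hW' : CMDiffAt ∞ (T% W') x) :
      mlieBracket I W (mlieBracket I W' (f • Z)) x
        = d% (fun y => d% f y (W' y)) x (W x) • Z x + d% f x (W' x) • mlieBracket I W Z x
          + (d% f x (W x) • mlieBracket I W' Z x
          + f x • mlieBracket I W (mlieBracket I W' Z) x) := by
    have hc := contMDiffAt_mvfderiv_apply hf hW'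
    have hb := contMDiffAt_mlieBracket hW' hZ
    rw [Filter.EventuallyEq.mlieBracket_vectorField_eq (Filter.EventuallyEq.refl _ W) step,
      mlieBracket_add_right (md (hc.smul_section hZ)) (md (hf.smul_section hb)),
      mlieBracket_smul_right (hc.mdifferentiableAt (by simp)) (md hZ),
      mlieBracket_smul_right (hf.mdifferentiableAt (by simp)) (md hb)]
  have : IsManifold I (minSmoothness ℝ 3) M := by
    simpa using IsManifold.of_le (n := ∞) (m := 3) ENat.LEInfty.out
  have J1 := leibniz_identity_mlieBracket_apply (I := I) (U := U) (V := V) (W := f • Z) (x := x)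
    (hU.of_le (by simpa using two_le_infty)) (hV.of_le (by simpa using two_le_infty))
    (hfZ.of_le (by simpa using two_le_infty))
  have J2 := leibniz_identity_mlieBracket_apply (I := I) (U := U) (V := V) (W := Z) (x := x)
    (hU.of_le (by simpa using two_le_infty)) (hV.of_le (by simpa using two_le_infty))
    (hZ.of_le (by simpa using two_le_infty))
  rw [outer hU hV, outer hV hU, mlieBracket_smul_right (hf.mdifferentiableAt (by simp)) (md hZ),
    J2] at J1
  have key : (d% (fun y => d% f y (V y)) x (U x) - d% (fun y => d% f y (U y)) x (V x)
      - d% f x (mlieBracket I U V x)) • Z x = 0 := by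
    rw [sub_smul, sub_smul]
    have J := sub_eq_zero.2 J1
    rw [← J]
    module
  rw [hZx] at key
  have := (smul_eq_zero.1 key).resolve_right hz
  linarith

end Derivations

section Connection

variable {E : Type*} [NormedAddCommGroup E] [NormedSpace ℝ E] [FiniteDimensional ℝ E]
  {H : Type*} [TopologicalSpace H] {I : ModelWithCorners ℝ E H}
  {M : Type*} [TopologicalSpace M] [ChartedSpace H M]
  [RiemannianBundle (fun x : M => TangentSpace I x)] [IsManifold I ∞ M]
  [IsContMDiffRiemannianBundle I ∞ E (fun x : M => TangentSpace I x)]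

theorem mvfderiv_inner {Y Z : Π x : M, TangentSpace I x} {x : M}
    (hY : MDiffAt (T% Y) x) (hZ : MDiffAt (T% Z) x) (v : TangentSpace I x) :
    d% (fun y => ⟪Y y, Z y⟫_ℝ) x v
      = ⟪leviCivita I Y x v, Z x⟫_ℝ + ⟪Y x, leviCivita I Z x v⟫_ℝ := by
  have h := (leviCivita_isMetricCompatible I (M := M)).mvfderiv_inner_eq
    (FiberBundle.extend E v) hY hZ
  simpa using h

theorem leviCivita_sub_swap {X Y : Π x : M, TangentSpace I x} {x : M}
    (hX : MDiffAt (T% X) x) (hY : MDiffAt (T% Y) x) :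
    leviCivita I Y x (X x) - leviCivita I X x (Y x) = mlieBracket I X Y x :=
  (CovariantDerivative.torsion_eq_zero_iff _).1 (leviCivita_torsion I) hX hY

theorem leviCivita_smul {f : M → ℝ} {X : Π x : M, TangentSpace I x} {x : M}
    (hf : MDiffAt f x) (hX : MDiffAt (T% X) x) (v : TangentSpace I x) :
    leviCivita I (f • X) x v = f x • leviCivita I X x v + d% f x v • X x := by
  rw [(leviCivita I).isCovariantDerivativeOnUniv.leibniz hX hf]
  simp

theorem leviCivita_add {X Y : Π x : M, TangentSpace I x} {x : M}
    (hX : MDiffAt (T% X) x) (hY : MDiffAt (T% Y) x) (v : TangentSpace I x) :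
    leviCivita I (X + Y) x v = leviCivita I X x v + leviCivita I Y x v := by
  rw [(leviCivita I).isCovariantDerivativeOnUniv.add hX hY]
  simp

theorem inner_grad_left (f : M → ℝ) (x : M) (v : TangentSpace I x) :
    ⟪grad I f x, v⟫_ℝ = d% f x v :=
  InnerProductSpace.toDual_symm_apply (𝕜 := ℝ) (E := TangentSpace I x)

theorem inner_grad_right (f : M → ℝ) (x : M) (v : TangentSpace I x) :
    ⟪v, grad I f x⟫_ℝ = d% f x v := by
  rw [real_inner_comm, inner_grad_left]

/-- The Hessian of a function is symmetric. -/
theorem inner_leviCivita_grad_comm {f : M → ℝ} {x : M} (hf : CMDiffAt ∞ f x)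
    (hgrad : MDiffAt (T% (grad I f)) x) (v w : TangentSpace I x) :
    ⟪leviCivita I (grad I f) x v, w⟫_ℝ = ⟪leviCivita I (grad I f) x w, v⟫_ℝ := by
  let V : Π x : M, TangentSpace I x := FiberBundle.extend E v
  let W : Π x : M, TangentSpace I x := FiberBundle.extend E w
  have hV : CMDiffAt ∞ (T% V) x := FiberBundle.contMDiffAt_extend I E _
  have hW : CMDiffAt ∞ (T% W) x := FiberBundle.contMDiffAt_extend I E _
  have hVx : V x = v := by simp [V]
  have hWx : W x = w := by simp [W]
  have hV' := hV.mdifferentiableAt (n := ∞) (by simp)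
  have hW' := hW.mdifferentiableAt (n := ∞) (by simp)
  have h1 := mvfderiv_inner hgrad hW' v
  have h2 := mvfderiv_inner hgrad hV' w
  have h3 := mvfderiv_mlieBracket hf hV hW
  rw [← leviCivita_sub_swap hV' hW', ← inner_grad_left, inner_sub_right] at h3
  simp only [inner_grad_left, hVx, hWx] at h1 h2 h3
  linarith

theorem divergence_smul {f : M → ℝ} {X : Π x : M, TangentSpace I x} {x : M}
    (hf : MDiffAt f x) (hX : MDiffAt (T% X) x) :
    divergence I (f • X) x = f x * divergence I X x + d% f x (X x) := by
  have : (leviCivita I (f • X) x).toLinearMap = f x • (leviCivita I X x).toLinearMap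
      + (d% f x).toLinearMap.smulRight (X x) := by
    ext v
    simp [leviCivita_smul hf hX]
  rw [divergence, this, map_add, map_smul, divergence]
  simp

theorem divergence_add {X Y : Π x : M, TangentSpace I x} {x : M}
    (hX : MDiffAt (T% X) x) (hY : MDiffAt (T% Y) x) :
    divergence I (X + Y) x = divergence I X x + divergence I Y x := by
  have : (leviCivita I (X + Y) x).toLinearMap = (leviCivita I X x).toLinearMap
      + (leviCivita I Y x).toLinearMap := by
    ext v
    simp [leviCivita_add hX hY]
  rw [divergence, this, map_add, divergence, divergence]

end Connection

section MatrixInverse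

variable {E : Type*} [NormedAddCommGroup E] [NormedSpace ℝ E]
  {H : Type*} [TopologicalSpace H] {I : ModelWithCorners ℝ E H}
  {M : Type*} [TopologicalSpace M] [ChartedSpace H M]
  {ι : Type*} [Fintype ι] [DecidableEq ι] {n : WithTop ℕ∞} {x : M}

theorem contMDiffAt_matrix_det {A : M → Matrix ι ι ℝ}
    (hA : ∀ i j, CMDiffAt n (fun y => A y i j) x) : CMDiffAt n (fun y => (A y).det) x := by
  simp only [Matrix.det_apply']
  exact contMDiffAt_finsetSum fun σ _ =>
    contMDiffAt_const.mul (contMDiffAt_finsetProd fun i _ => hA _ _)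

theorem contMDiffAt_matrix_inv_apply {A : M → Matrix ι ι ℝ}
    (hA : ∀ i j, CMDiffAt n (fun y => A y i j) x) (hdet : (A x).det ≠ 0) (i j : ι) :
    CMDiffAt n (fun y => (A y)⁻¹ i j) x := by
  simp only [Matrix.inv_def, Ring.inverse_eq_inv', Matrix.smul_apply, smul_eq_mul,
    Matrix.adjugate_apply]
  refine ((contMDiffAt_matrix_det hA).inv₀ hdet).mul (contMDiffAt_matrix_det fun k l => ?_)
  simp only [Matrix.updateRow_apply]
  split_ifs
  · exact contMDiffAt_const
  · exact hA _ _

end MatrixInverse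

section Smoothness

variable {E : Type*} [NormedAddCommGroup E] [NormedSpace ℝ E] [FiniteDimensional ℝ E]
  {H : Type*} [TopologicalSpace H] {I : ModelWithCorners ℝ E H}
  {M : Type*} [TopologicalSpace M] [ChartedSpace H M]
  [RiemannianBundle (fun x : M => TangentSpace I x)] [IsManifold I ∞ M]
  [IsContMDiffRiemannianBundle I ∞ E (fun x : M => TangentSpace I x)]

theorem contMDiffAt_inner {X Y : Π x : M, TangentSpace I x} {x : M}
    (hX : CMDiffAt ∞ (T% X) x) (hY : CMDiffAt ∞ (T% Y) x) :
    CMDiffAt ∞ (fun y => ⟪X y, Y y⟫_ℝ) x :=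
  ContMDiffAt.inner_bundle (E := fun x : M => TangentSpace I x) (b := fun y => y) hX hY

/-- A vector field is smooth if its inner products with smooth vector fields are. -/
theorem contMDiffAt_of_inner {X : Π x : M, TangentSpace I x} {x : M}
    (h : ∀ Z : Π x : M, TangentSpace I x, CMDiffAt ∞ (T% Z) x →
      CMDiffAt ∞ (fun y => ⟪X y, Z y⟫_ℝ) x) :
    CMDiffAt ∞ (T% X) x := by
  classical
  let e := trivializationAt E (TangentSpace I : M → Type _) x
  have hx : x ∈ e.baseSet := FiberBundle.mem_baseSet_trivializationAt E _ x
  let b := Module.finBasis ℝ E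
  let s := e.localFrame b
  have hs (i) : CMDiffAt ∞ (T% (s i)) x := contMDiffAt_localFrame_of_mem ∞ e b i hx
  let A : M → Matrix _ _ ℝ := fun y => Matrix.of fun i j => ⟪s i y, s j y⟫_ℝ
  have hA (i j) : CMDiffAt ∞ (fun y => A y i j) x := contMDiffAt_inner (hs i) (hs j)
  have hdet {y : M} (hy : y ∈ e.baseSet) : (A y).det ≠ 0 := by
    have hli : LinearIndependent ℝ (fun i => s i y) :=
      (e.isLocalFrameOn_localFrame_baseSet I ∞ b).linearIndependent hy
    have := Matrix.posDef_gram_of_linearIndependent hli (𝕜 := ℝ)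
    exact this.det_pos.ne'
  rw [contMDiffAt_iff_localFrameCoeff b hx]
  intro i
  have hsum : CMDiffAt ∞ (fun y => ∑ j, (A y)⁻¹ i j * ⟪X y, s j y⟫_ℝ) x :=
    contMDiffAt_finsetSum fun j _ =>
      (contMDiffAt_matrix_inv_apply hA (hdet hx) i j).mul (h _ (hs j))
  refine hsum.congr_of_eventuallyEq ?_
  filter_upwards [e.open_baseSet.mem_nhds hx] with y hy
  have hX := e.eq_sum_localFrameCoeff_smul (I := I) (b := b) (s := X) hy
  have hin : (fun j => ⟪X y, s j y⟫_ℝ)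
      = (A y).mulVec (fun k => e.localFrameCoeff I b k y (X y)) := by
    ext j
    conv_lhs => rw [hX]
    rw [sum_inner, Matrix.mulVec, dotProduct]
    refine Finset.sum_congr rfl fun k _ => ?_
    rw [real_inner_smul_left, mul_comm, real_inner_comm]
    rfl
  have := congrArg (fun v => (A y)⁻¹.mulVec v i) hin
  simp only [Matrix.mulVec_mulVec, Matrix.nonsing_inv_mul _ (hdet hy).isUnit,
    Matrix.one_mulVec] at this
  exact this.symm

theorem contMDiff_grad {f : M → ℝ} (hf : CMDiff ∞ f) : CMDiff ∞ (T% (grad I f)) := fun x =>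
  contMDiffAt_of_inner fun Z hZ => by
    simpa only [inner_grad_left] using contMDiffAt_mvfderiv_apply (hf x) hZ

theorem contMDiffAt_koszul {X Y Z : Π x : M, TangentSpace I x} {x : M}
    (hX : CMDiffAt ∞ (T% X) x) (hY : CMDiffAt ∞ (T% Y) x) (hZ : CMDiffAt ∞ (T% Z) x) :
    CMDiffAt ∞ (koszul I X Y Z) x := by
  unfold koszul
  exact contMDiffAt_const.mul
    ((((((contMDiffAt_mvfderiv_apply (contMDiffAt_inner hY hZ) hX).add
      (contMDiffAt_mvfderiv_apply (contMDiffAt_inner hX hZ) hY)).sub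
      (contMDiffAt_mvfderiv_apply (contMDiffAt_inner hX hY) hZ)).add
      (contMDiffAt_inner (contMDiffAt_mlieBracket hX hY) hZ)).sub
      (contMDiffAt_inner (contMDiffAt_mlieBracket hX hZ) hY)).sub
      (contMDiffAt_inner (contMDiffAt_mlieBracket hY hZ) hX))

theorem contMDiffAt_leviCivita_apply {X Y : Π x : M, TangentSpace I x} {x : M}
    (hX : CMDiffAt ∞ (T% X) x) (hY : CMDiffAt ∞ (T% Y) x) :
    CMDiffAt ∞ (T% (fun y => leviCivita I Y y (X y))) x :=
  contMDiffAt_of_inner fun Z hZ => by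
    refine (contMDiffAt_koszul hX hY hZ).congr_of_eventuallyEq ?_
    filter_upwards [eventually_mdifferentiableAt_section hX,
      eventually_mdifferentiableAt_section hY, eventually_mdifferentiableAt_section hZ]
      with y h1 h2 h3
    exact inner_leviCivita I h1 h2 h3

theorem contMDiff_divergence {X : Π x : M, TangentSpace I x} (hX : CMDiff ∞ (T% X)) :
    CMDiff ∞ (divergence I X) := by
  intro x
  let e := trivializationAt E (TangentSpace I : M → Type _) x
  have hx : x ∈ e.baseSet := FiberBundle.mem_baseSet_trivializationAt E _ x
  let b := Module.finBasis ℝ E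
  let s := e.localFrame b
  have hs (i) : CMDiffAt ∞ (T% (s i)) x := contMDiffAt_localFrame_of_mem ∞ e b i hx
  have hsum : CMDiffAt ∞ (fun y => ∑ i, LinearMap.piApply (e.localFrameCoeff I b i)
      (fun y => leviCivita I X y (s i y)) y) x :=
    contMDiffAt_finsetSum fun i _ =>
      contMDiffAt_localFrameCoeff b hx (contMDiffAt_leviCivita_apply (hs i) (hX x)) i
  refine hsum.congr_of_eventuallyEq ?_
  filter_upwards [e.open_baseSet.mem_nhds hx] with y hy
  rw [divergence, LinearMap.trace_eq_matrix_trace ℝ (e.basisAt b hy), Matrix.trace]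
  refine Finset.sum_congr rfl fun i _ => ?_
  rw [LinearMap.piApply_apply_apply, e.localFrameCoeff_apply_of_mem_baseSet b hy
    (fun y => leviCivita I X y (s i y)), Matrix.diag_apply, LinearMap.toMatrix_apply]
  simp [s, hy]

end Smoothness

section Primitive

/-- If a continuous function on a space factors as `A ∘ ψ`, then `A` is continuous on the segment
between the values of `ψ` at the ends of any path. -/
theorem continuousOn_uIcc_of_comp_continuous {M : Type*} [TopologicalSpace M] {ψ a : M → ℝ}
    (hψ : Continuous ψ) (ha : Continuous a) {A : ℝ → ℝ} (hA : ∀ x, a x = A (ψ x)) {x y : M}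
    (hxy : Joined x y) : ContinuousOn A (Set.uIcc (ψ x) (ψ y)) := by
  obtain ⟨γ⟩ := hxy
  let f : unitInterval → ℝ := fun t => ψ (γ t)
  have hf : Continuous f := hψ.comp γ.continuous
  have hq : Topology.IsQuotientMap (Set.rangeFactorization f) :=
    .of_surjective_continuous Set.rangeFactorization_surjective hf.rangeFactorization
  have hr : ContinuousOn A (Set.range f) := by
    rw [continuousOn_iff_continuous_domRestrict, hq.continuous_iff]
    have : (Set.range f).domRestrict A ∘ Set.rangeFactorization f = fun t => a (γ t) := by
      ext t
      exact (hA _).symm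
    rw [this]
    exact ha.comp γ.continuous
  have hc : (Set.range f).OrdConnected := (isPreconnected_range hf).ordConnected
  exact hr.mono (hc.uIcc_subset ⟨0, by simp [f]⟩ ⟨1, by simp [f]⟩)

/-- If a continuous function on a locally path-connected space factors through `ψ`, then `a dψ` has
a primitive. -/
theorem exists_primitive {M : Type*} [TopologicalSpace M] [LocallyPathConnectedSpace M]
    {ψ a : M → ℝ} (hψ : Continuous ψ) (ha : Continuous a) {A : ℝ → ℝ}
    (hA : ∀ x, a x = A (ψ x)) :
    ∃ h : M → ℝ, ∀ x,
      (fun y => h y - h x - a x * (ψ y - ψ x)) =o[𝓝 x] fun y => ψ y - ψ x := by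
  let base : M → M := fun x => (Quotient.mk (pathSetoid M) x).out
  have hbase (x : M) : Joined (base x) x := Quotient.exact (s := pathSetoid M) (Quotient.out_eq _)
  refine ⟨fun x => ∫ t in (ψ (base x))..(ψ x), A t, fun x => ?_⟩
  have hint {y z : M} (hyz : Joined y z) :
      IntervalIntegrable A MeasureTheory.volume (ψ y) (ψ z) :=
    (continuousOn_uIcc_of_comp_continuous hψ ha hA hyz).intervalIntegrable
  rw [Asymptotics.isLittleO_iff]
  intro ε hε
  obtain ⟨U, ⟨hU, hUc⟩, hUs⟩ := (path_connected_basis x).mem_iff.1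
    (ha.continuousAt.preimage_mem_nhds (Metric.ball_mem_nhds (a x) hε))
  filter_upwards [hU] with y hy
  have hx : x ∈ U := mem_of_mem_nhds hU
  have hxy : Joined x y := (hUc.joinedIn x hx y hy).joined
  have hb : base y = base x := by
    have : Quotient.mk (pathSetoid M) y = Quotient.mk (pathSetoid M) x :=
      Quotient.sound (s := pathSetoid M) hxy.symm
    simp only [base, this]
  have hsub : (∫ t in (ψ (base y))..(ψ y), A t) - (∫ t in (ψ (base x))..(ψ x), A t)
      - a x * (ψ y - ψ x) = ∫ t in (ψ x)..(ψ y), (A t - a x) := by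
    rw [hb, intervalIntegral.integral_interval_sub_left (hint ((hbase x).trans hxy))
      (hint (hbase x)), intervalIntegral.integral_sub (hint hxy) (by simp)]
    simp [mul_comm]
  rw [hsub, Real.norm_eq_abs (ψ y - ψ x)]
  refine intervalIntegral.norm_integral_le_of_norm_le_const fun t ht => ?_
  have hconn : (ψ '' U).OrdConnected :=
    (hUc.isConnected.isPreconnected.image ψ hψ.continuousOn).ordConnected
  obtain ⟨z, hz, rfl⟩ := hconn.uIcc_subset ⟨x, hx, rfl⟩ ⟨y, hy, rfl⟩ (Set.uIoc_subset_uIcc ht)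
  rw [← hA z, ← dist_eq_norm]
  exact (hUs hz).le

variable {E : Type*} [NormedAddCommGroup E] [NormedSpace ℝ E]
  {H : Type*} [TopologicalSpace H] {I : ModelWithCorners ℝ E H} [I.Boundaryless]
  {M : Type*} [TopologicalSpace M] [ChartedSpace H M] [IsManifold I ∞ M]

theorem contDiffOn_comp_extChartAt_symm {f : M → ℝ} (hf : CMDiff ∞ f) (x : M) :
    ContDiffOn ℝ ∞ (f ∘ (extChartAt I x).symm) (extChartAt I x).target := by
  rw [← contMDiffOn_iff_contDiffOn]
  exact hf.comp_contMDiffOn (contMDiffOn_extChartAt_symm x)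

theorem mvfderiv_eq_fderiv_comp_extChartAt_symm {f : M → ℝ} {x : M} (hf : MDiffAt f x) :
    d% f x = fderiv ℝ (f ∘ (extChartAt I x).symm) (extChartAt I x x) := by
  rw [hf.mvfderiv, I.range_eq_univ, fderivWithin_univ]
  rfl

/-- A primitive of `a dψ` with `a` and `ψ` smooth is smooth. -/
theorem contMDiff_of_isLittleO {ψ a h : M → ℝ} (hψ : CMDiff ∞ ψ) (ha : CMDiff ∞ a)
    (hh : ∀ x, (fun y => h y - h x - a x * (ψ y - ψ x)) =o[𝓝 x] fun y => ψ y - ψ x) :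
    CMDiff ∞ h ∧ ∀ x, d% h x = a x • d% ψ x := by
  have hderiv (x : M) {z : E} (hz : z ∈ (extChartAt I x).target) :
      HasFDerivAt (h ∘ (extChartAt I x).symm)
        (a ((extChartAt I x).symm z) • fderiv ℝ (ψ ∘ (extChartAt I x).symm) z) z := by
    have ho := isOpen_extChartAt_target (I := I) x
    have hd : HasFDerivAt (ψ ∘ (extChartAt I x).symm)
        (fderiv ℝ (ψ ∘ (extChartAt I x).symm) z) z :=
      (((contDiffOn_comp_extChartAt_symm hψ x).contDiffAt (ho.mem_nhds hz)).differentiableAt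
        (by simp)).hasFDerivAt
    have hc : Filter.Tendsto (extChartAt I x).symm (𝓝 z) (𝓝 ((extChartAt I x).symm z)) :=
      (continuousOn_extChartAt_symm x).continuousAt (ho.mem_nhds hz)
    have h1 := ((hh ((extChartAt I x).symm z)).comp_tendsto hc).trans_isBigO hd.isBigO_sub
    have h2 := hd.isLittleO.const_mul_left (a ((extChartAt I x).symm z))
    refine HasFDerivAt.of_isLittleO ((h1.add h2).congr_left fun w => ?_)
    simp
    ring
  have hsmooth : CMDiff ∞ h := by
    intro x
    have ho := isOpen_extChartAt_target (I := I) x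
    have hC : ContDiffOn ℝ ∞ (h ∘ (extChartAt I x).symm) (extChartAt I x).target := by
      rw [contDiffOn_infty_iff_fderiv_of_isOpen ho]
      refine ⟨fun z hz => (hderiv x hz).differentiableAt.differentiableWithinAt, ?_⟩
      refine ContDiffOn.congr (f := fun z => a ((extChartAt I x).symm z) •
        fderiv ℝ (ψ ∘ (extChartAt I x).symm) z) ?_ fun z hz => (hderiv x hz).fderiv
      exact (contDiffOn_comp_extChartAt_symm ha x).smul
        ((contDiffOn_infty_iff_fderiv_of_isOpen ho).1 (contDiffOn_comp_extChartAt_symm hψ x)).2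
    have hx := hC.contDiffAt (ho.mem_nhds (mem_extChartAt_target x))
    refine (hx.contMDiffAt.comp x contMDiffAt_extChartAt).congr_of_eventuallyEq ?_
    filter_upwards [extChartAt_source_mem_nhds (I := I) x] with y hy
    exact congrArg h ((extChartAt I x).left_inv hy).symm
  refine ⟨hsmooth, fun x => ?_⟩
  rw [mvfderiv_eq_fderiv_comp_extChartAt_symm ((hsmooth x).mdifferentiableAt (by simp)),
    mvfderiv_eq_fderiv_comp_extChartAt_symm ((hψ x).mdifferentiableAt (by simp)),
    (hderiv x (mem_extChartAt_target x)).fderiv, extChartAt_to_inv]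
  rfl

/-- If a smooth function factors through `ψ`, its differential vanishes on the kernel of a nonzero
differential of `ψ`. -/
theorem mvfderiv_eq_zero_of_comp [CompleteSpace E] {ψ a : M → ℝ} (hψ : CMDiff ∞ ψ) (ha : CMDiff ∞ a)
    {A : ℝ → ℝ} (hA : ∀ x, a x = A (ψ x)) {x : M} {v w : TangentSpace I x}
    (hv : d% ψ x v = 0) (hw : d% ψ x w ≠ 0) : d% a x v = 0 := by
  by_contra hav
  have ho := isOpen_extChartAt_target (I := I) x
  have hstrict {f : M → ℝ} (hf : CMDiff ∞ f) :
      HasStrictFDerivAt (f ∘ (extChartAt I x).symm) (d% f x : E →L[ℝ] ℝ) (extChartAt I x x) := by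
    rw [mvfderiv_eq_fderiv_comp_extChartAt_symm ((hf x).mdifferentiableAt (by simp))]
    exact ((contDiffOn_comp_extChartAt_symm hf x).contDiffAt
      (ho.mem_nhds (mem_extChartAt_target x))).hasStrictFDerivAt (by simp)
  have hsurj : ((d% ψ x : E →L[ℝ] ℝ).prod (d% a x : E →L[ℝ] ℝ)).range = ⊤ := by
    rw [LinearMap.range_eq_top]
    rintro ⟨p, q⟩
    let u : TangentSpace I x := (p / d% ψ x w) • w
      + ((q - p / d% ψ x w * d% a x w) / d% a x v) • v
    have h1 : d% ψ x u = p := by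
      simp [u, hv, hw]
    have h2 : d% a x u = q := by
      simp [u, hav]
    exact ⟨u, Prod.ext h1 h2⟩
  have hmap := ((hstrict hψ).prodMk (hstrict ha)).map_nhds_eq_of_surj hsurj
  have hgraph : {p : ℝ × ℝ | p.2 = A p.1} ∈ 𝓝 (ψ x, a x) := by
    have : ((ψ ∘ (extChartAt I x).symm) (extChartAt I x x),
        (a ∘ (extChartAt I x).symm) (extChartAt I x x)) = (ψ x, a x) := by simp
    rw [← this, ← hmap, Filter.mem_map]
    exact Filter.univ_mem' fun z => hA _
  have hline : Filter.Tendsto (fun t : ℝ => (ψ x, t)) (𝓝 (a x)) (𝓝 (ψ x, a x)) :=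
    (Continuous.prodMk_right (ψ x)).tendsto _
  have hev : ∀ᶠ t in 𝓝[≠] (a x), t = A (ψ x) := nhdsWithin_le_nhds (hline hgraph)
  obtain ⟨t, ht, hne⟩ := (hev.and self_mem_nhdsWithin).exists
  exact hne (by simpa [hA x] using ht)

end Primitive

section OrthogonalFrame

variable {V : Type*} [NormedAddCommGroup V] [InnerProductSpace ℝ V]

/-- The orthonormal basis obtained by normalizing three orthogonal nonzero vectors. -/
theorem exists_orthonormalBasis_smul (h3 : Module.finrank ℝ V = 3) {a b c : V}
    (hab : ⟪a, b⟫_ℝ = 0) (hac : ⟪a, c⟫_ℝ = 0) (hbc : ⟪b, c⟫_ℝ = 0)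
    (ha : a ≠ 0) (hb : b ≠ 0) (hc : c ≠ 0) :
    ∃ e : OrthonormalBasis (Fin 3) ℝ V,
      e 0 = ‖a‖⁻¹ • a ∧ e 1 = ‖b‖⁻¹ • b ∧ e 2 = ‖c‖⁻¹ • c := by
  have hor : Orthonormal ℝ ![‖a‖⁻¹ • a, ‖b‖⁻¹ • b, ‖c‖⁻¹ • c] := by
    rw [orthonormal_iff_ite]
    intro i j
    have ha' := norm_ne_zero_iff.2 ha
    have hb' := norm_ne_zero_iff.2 hb
    have hc' := norm_ne_zero_iff.2 hc
    have hba := (real_inner_comm a b).trans hab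
    have hca := (real_inner_comm a c).trans hac
    have hcb := (real_inner_comm b c).trans hbc
    fin_cases i <;> fin_cases j <;>
      simp [real_inner_smul_left, real_inner_smul_right, hab, hac, hbc, hba, hca, hcb, norm_smul,
        ha', hb', hc']
  have : FiniteDimensional ℝ V := Module.finite_of_finrank_pos (by omega)
  refine ⟨(basisOfOrthonormalOfCardEqFinrank hor (by simp [h3])).toOrthonormalBasis
    (by simpa using hor), ?_, ?_, ?_⟩ <;> simp

theorem ext_of_orthogonal (h3 : Module.finrank ℝ V = 3) {a b c : V}
    (hab : ⟪a, b⟫_ℝ = 0) (hac : ⟪a, c⟫_ℝ = 0) (hbc : ⟪b, c⟫_ℝ = 0)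
    (ha : a ≠ 0) (hb : b ≠ 0) (hc : c ≠ 0) {v w : V} (h1 : ⟪v, a⟫_ℝ = ⟪w, a⟫_ℝ)
    (h2 : ⟪v, b⟫_ℝ = ⟪w, b⟫_ℝ) (h3' : ⟪v, c⟫_ℝ = ⟪w, c⟫_ℝ) : v = w := by
  obtain ⟨e, e0, e1, e2⟩ := exists_orthonormalBasis_smul h3 hab hac hbc ha hb hc
  refine InnerProductSpace.ext_inner_right_basis e.toBasis fun i => ?_
  fin_cases i <;> simp [e0, e1, e2, real_inner_smul_right, h1, h2, h3']

theorem trace_eq_of_orthogonal (h3 : Module.finrank ℝ V = 3) {a b c : V}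
    (hab : ⟪a, b⟫_ℝ = 0) (hac : ⟪a, c⟫_ℝ = 0) (hbc : ⟪b, c⟫_ℝ = 0)
    (ha : a ≠ 0) (hb : b ≠ 0) (hc : c ≠ 0) (A : V →ₗ[ℝ] V) :
    LinearMap.trace ℝ V A = ⟪A a, a⟫_ℝ / ⟪a, a⟫_ℝ + ⟪A b, b⟫_ℝ / ⟪b, b⟫_ℝ
      + ⟪A c, c⟫_ℝ / ⟪c, c⟫_ℝ := by
  obtain ⟨e, e0, e1, e2⟩ := exists_orthonormalBasis_smul h3 hab hac hbc ha hb hc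
  have h (v : V) : ⟪‖v‖⁻¹ • v, A (‖v‖⁻¹ • v)⟫_ℝ = ⟪A v, v⟫_ℝ / ⟪v, v⟫_ℝ := by
    rw [map_smul, real_inner_smul_left, real_inner_smul_right, real_inner_self_eq_norm_sq,
      real_inner_comm]
    ring
  rw [LinearMap.trace_eq_sum_inner A e, Fin.sum_univ_three, e0, e1, e2, h, h, h]

theorem trace_eq_zero_of_skew [FiniteDimensional ℝ V] (A : V →ₗ[ℝ] V)
    (hA : ∀ v w, ⟪A v, w⟫_ℝ = -⟪v, A w⟫_ℝ) : LinearMap.trace ℝ V A = 0 := by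
  rw [LinearMap.trace_eq_sum_inner A (stdOrthonormalBasis ℝ V)]
  refine Finset.sum_eq_zero fun i _ => ?_
  have := hA (stdOrthonormalBasis ℝ V i) (stdOrthonormalBasis ℝ V i)
  rw [real_inner_comm] at this
  linarith

theorem trace_comp_eq_zero_of_skew_of_symmetric [FiniteDimensional ℝ V] (A B : V →ₗ[ℝ] V)
    (hA : ∀ v w, ⟪A v, w⟫_ℝ = -⟪v, A w⟫_ℝ) (hB : ∀ v w, ⟪B v, w⟫_ℝ = ⟪B w, v⟫_ℝ) :
    LinearMap.trace ℝ V (A ∘ₗ B) = 0 := by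
  have h1 : LinearMap.trace ℝ V (A ∘ₗ B) = -LinearMap.trace ℝ V (B ∘ₗ A) := by
    rw [LinearMap.trace_eq_sum_inner (A ∘ₗ B) (stdOrthonormalBasis ℝ V),
      LinearMap.trace_eq_sum_inner (B ∘ₗ A) (stdOrthonormalBasis ℝ V), ← Finset.sum_neg_distrib]
    refine Finset.sum_congr rfl fun i _ => ?_
    simp only [LinearMap.comp_apply]
    rw [real_inner_comm, hA, hB, real_inner_comm]
  have h2 : LinearMap.trace ℝ V (A ∘ₗ B) = LinearMap.trace ℝ V (B ∘ₗ A) :=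
    LinearMap.trace_mul_comm ℝ A B
  linarith

end OrthogonalFrame

section Fields

variable {E : Type*} [NormedAddCommGroup E] [NormedSpace ℝ E]
  {H : Type*} [TopologicalSpace H] (I : ModelWithCorners ℝ E H)
  {M : Type*} [TopologicalSpace M] [ChartedSpace H M] [IsManifold I ∞ M]

/-- A smooth vector field. -/
abbrev IsSmoothField (X : Π x : M, TangentSpace I x) : Prop := CMDiff ∞ (T% X)

/-- A vector field smooth at a point. -/
abbrev IsSmoothFieldAt (X : Π x : M, TangentSpace I x) (x : M) : Prop := CMDiffAt ∞ (T% X) x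

/-- A vector field differentiable at a point. -/
abbrev IsDiffFieldAt (X : Π x : M, TangentSpace I x) (x : M) : Prop := MDiffAt (T% X) x

/-- A smooth real function. -/
abbrev IsSmoothFunction (f : M → ℝ) : Prop := CMDiff ∞ f

variable {I}

theorem IsSmoothField.diffAt {X : Π x : M, TangentSpace I x} (hX : IsSmoothField I X) (x : M) :
    IsDiffFieldAt I X x :=
  (hX x).mdifferentiableAt (by simp)

theorem IsSmoothFunction.diffAt {f : M → ℝ} (hf : IsSmoothFunction I f) (x : M) : MDiffAt f x :=
  (hf x).mdifferentiableAt (by simp)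

theorem IsSmoothFunction.comp_left {G : ℝ → ℝ} {f : M → ℝ} (hG : ContDiff ℝ ∞ G)
    (hf : IsSmoothFunction I f) : IsSmoothFunction I (fun y => G (f y)) :=
  hG.contMDiff.comp hf

theorem mvfderiv_comp_left {G : ℝ → ℝ} {f : M → ℝ} {x : M} (hG : DifferentiableAt ℝ G (f x))
    (hf : MDiffAt f x) (v : TangentSpace I x) :
    d% (fun y => G (f y)) x v = deriv G (f x) * d% f x v := by
  have h := (hG.hasDerivAt.hasFDerivAt.hasMFDerivAt.comp x hf.hasMFDerivAt).mfderiv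
  change mfderiv I 𝓘(ℝ, ℝ) (G ∘ f) x v = _
  rw [h]
  exact mul_comm (d% f x v : ℝ) (deriv G (f x))

end Fields

section Sasakian

variable {M : Type*} [TopologicalSpace M]
  [ChartedSpace (EuclideanSpace ℝ (Fin 3)) M] [IsManifold (𝓡 3) ∞ M]
  [RiemannianBundle (fun x : M => TangentSpace (𝓡 3) x)]
  [IsContMDiffRiemannianBundle (𝓡 3) ∞ (EuclideanSpace ℝ (Fin 3))
    (fun x : M => TangentSpace (𝓡 3) x)]

theorem finrank_tangentSpace (x : M) : Module.finrank ℝ (TangentSpace (𝓡 3) x) = 3 :=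
  finrank_euclideanSpace_fin (𝕜 := ℝ) (n := 3)

theorem grad_comp {G : ℝ → ℝ} {ψ : M → ℝ} {x : M} (hG : DifferentiableAt ℝ G (ψ x))
    (hψ : MDifferentiableAt (𝓡 3) 𝓘(ℝ, ℝ) ψ x) :
    grad (𝓡 3) (fun y => G (ψ y)) x = deriv G (ψ x) • grad (𝓡 3) ψ x := by
  refine ext_inner_right ℝ fun v => ?_
  rw [real_inner_smul_left, inner_grad_left, inner_grad_left]
  exact mvfderiv_comp_left hG hψ v

namespace SasakianStructure

variable (S : SasakianStructure M)

theorem mdifferentiableAt_ξ (x : M) : IsDiffFieldAt (𝓡 3) S.ξ x :=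
  (S.killing.1 x).mdifferentiableAt (by simp)

theorem inner_ξ_ξ (x : M) : ⟪S.ξ x, S.ξ x⟫_ℝ = 1 := by rw [← S.η_eq, S.η_ξ]

theorem ξ_ne_zero (x : M) : S.ξ x ≠ 0 := fun h => by simpa [h] using S.inner_ξ_ξ x

theorem inner_leviCivita_ξ_skew (x : M) (v w : TangentSpace (𝓡 3) x) :
    ⟪leviCivita (𝓡 3) S.ξ x v, w⟫_ℝ = -⟪v, leviCivita (𝓡 3) S.ξ x w⟫_ℝ := by
  let V : Π x : M, TangentSpace (𝓡 3) x := FiberBundle.extend (EuclideanSpace ℝ (Fin 3)) v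
  let W : Π x : M, TangentSpace (𝓡 3) x := FiberBundle.extend (EuclideanSpace ℝ (Fin 3)) w
  have hV : IsSmoothFieldAt (𝓡 3) V x := FiberBundle.contMDiffAt_extend _ _ _
  have hW : IsSmoothFieldAt (𝓡 3) W x := FiberBundle.contMDiffAt_extend _ _ _
  have hVx : V x = v := by simp [V]
  have hWx : W x = w := by simp [W]
  have hV' := hV.mdifferentiableAt (n := ∞) (by simp)
  have hW' := hW.mdifferentiableAt (n := ∞) (by simp)
  have h := S.killing.2 x V W hV hW
  rw [mvfderiv_inner hV' hW', ← leviCivita_sub_swap (S.mdifferentiableAt_ξ x) hV',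
    ← leviCivita_sub_swap (S.mdifferentiableAt_ξ x) hW', inner_sub_left, inner_sub_right,
    hVx, hWx] at h
  linarith

theorem extDeriv_η (x : M) (v w : TangentSpace (𝓡 3) x) :
    extDeriv (𝓡 3) S.η S.smooth_η x v w = 2 * ⟪leviCivita (𝓡 3) S.ξ x v, w⟫_ℝ := by
  let V : Π x : M, TangentSpace (𝓡 3) x := FiberBundle.extend (EuclideanSpace ℝ (Fin 3)) v
  let W : Π x : M, TangentSpace (𝓡 3) x := FiberBundle.extend (EuclideanSpace ℝ (Fin 3)) w
  have hV : IsDiffFieldAt (𝓡 3) V x := FiberBundle.mdifferentiableAt_extend _ _ _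
  have hW : IsDiffFieldAt (𝓡 3) W x := FiberBundle.mdifferentiableAt_extend _ _ _
  have hVx : V x = v := by simp [V]
  have hWx : W x = w := by simp [W]
  have h := extDeriv_apply (𝓡 3) S.smooth_η hV hW
  simp only [S.η_eq] at h
  rw [mvfderiv_inner hW (S.mdifferentiableAt_ξ x), mvfderiv_inner hV (S.mdifferentiableAt_ξ x),
    ← leviCivita_sub_swap hV hW, inner_sub_left, hVx, hWx] at h
  have := S.inner_leviCivita_ξ_skew x v w
  rw [real_inner_comm (leviCivita (𝓡 3) S.ξ x v) w] at h
  linarith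

theorem leviCivita_ξ (x : M) (v : TangentSpace (𝓡 3) x) :
    leviCivita (𝓡 3) S.ξ x v = -S.φ x v := by
  refine ext_inner_left ℝ fun w => ?_
  have h1 := S.half_dη x w v
  rw [S.extDeriv_η] at h1
  have h2 := S.inner_leviCivita_ξ_skew x w v
  rw [inner_neg_right]
  linarith

theorem inner_φ_left (x : M) (v w : TangentSpace (𝓡 3) x) :
    ⟪S.φ x v, w⟫_ℝ = -⟪v, S.φ x w⟫_ℝ := by
  have h := S.inner_leviCivita_ξ_skew x v w
  simp only [S.leviCivita_ξ, inner_neg_left, inner_neg_right] at h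
  linarith

theorem inner_φ_self (x : M) (v : TangentSpace (𝓡 3) x) : ⟪v, S.φ x v⟫_ℝ = 0 := by
  have h := S.inner_φ_left x v v
  rw [real_inner_comm] at h
  linarith

theorem inner_φ_ξ (x : M) (v : TangentSpace (𝓡 3) x) : ⟪S.φ x v, S.ξ x⟫_ℝ = 0 := by
  rw [real_inner_comm, ← S.half_dη, S.dη_ξ, mul_zero]

theorem φ_ξ (x : M) : S.φ x (S.ξ x) = 0 := by
  refine ext_inner_right ℝ fun v => ?_
  rw [S.inner_φ_left, real_inner_comm, S.inner_φ_ξ]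
  simp

theorem φ_φ {x : M} {v : TangentSpace (𝓡 3) x} (hv : ⟪v, S.ξ x⟫_ℝ = 0) :
    S.φ x (S.φ x v) = -v := by
  rw [S.φ_sq, S.η_eq, hv]
  simp

theorem inner_φ_φ {x : M} {v : TangentSpace (𝓡 3) x} (hv : ⟪v, S.ξ x⟫_ℝ = 0) :
    ⟪S.φ x v, S.φ x v⟫_ℝ = ⟪v, v⟫_ℝ := by
  rw [S.inner_φ_left, S.φ_φ hv, inner_neg_right, neg_neg]

theorem divergence_ξ (x : M) : divergence (𝓡 3) S.ξ x = 0 :=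
  trace_eq_zero_of_skew _ fun v w => S.inner_leviCivita_ξ_skew x v w

theorem contMDiff_φ_apply {X : Π x : M, TangentSpace (𝓡 3) x} (hX : IsSmoothField (𝓡 3) X) :
    IsSmoothField (𝓡 3) (fun y => S.φ y (X y)) :=
  ContMDiff.clm_bundle_apply (E₁ := fun x : M => TangentSpace (𝓡 3) x)
    (E₂ := fun x : M => TangentSpace (𝓡 3) x) (b := fun y => y) S.smooth_φ hX

/-- Where a field vanishes, covariant differentiation commutes with `φ`. -/
theorem leviCivita_φ_of_eq_zero {X : Π x : M, TangentSpace (𝓡 3) x} (hX : IsSmoothField (𝓡 3) X)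
    {x : M} (hx : X x = 0) (v : TangentSpace (𝓡 3) x) :
    leviCivita (𝓡 3) (fun y => S.φ y (X y)) x v = S.φ x (leviCivita (𝓡 3) X x v) := by
  refine ext_inner_right ℝ fun w => ?_
  let W : Π x : M, TangentSpace (𝓡 3) x := FiberBundle.extend (EuclideanSpace ℝ (Fin 3)) w
  have hW : IsDiffFieldAt (𝓡 3) W x := FiberBundle.mdifferentiableAt_extend _ _ _
  have hWx : W x = w := by simp [W]
  have hφW : IsDiffFieldAt (𝓡 3) (fun y => S.φ y (W y)) x :=
    MDifferentiableAt.clm_bundle_apply (E₁ := fun x : M => TangentSpace (𝓡 3) x)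
      (E₂ := fun x : M => TangentSpace (𝓡 3) x) (b := fun y => y)
      ((S.smooth_φ x).mdifferentiableAt (by simp)) hW
  have h1 := mvfderiv_inner ((S.contMDiff_φ_apply hX x).mdifferentiableAt (by simp)) hW v
  have h2 := mvfderiv_inner ((hX x).mdifferentiableAt (by simp)) hφW v
  simp only [S.inner_φ_left] at h1
  rw [mvfderiv_fun_neg] at h1
  simp only [neg_apply, h2, hx, hWx, inner_zero_left, add_zero, neg_zero] at h1
  rw [S.inner_φ_left]
  exact h1.symm

end SasakianStructure

end Sasakian

section InvariantFunction

variable {M : Type*} [TopologicalSpace M]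
  [ChartedSpace (EuclideanSpace ℝ (Fin 3)) M] [IsManifold (𝓡 3) ∞ M]
  [RiemannianBundle (fun x : M => TangentSpace (𝓡 3) x)]
  [IsContMDiffRiemannianBundle (𝓡 3) ∞ (EuclideanSpace ℝ (Fin 3))
    (fun x : M => TangentSpace (𝓡 3) x)]

/-- The squared norm of the gradient. -/
def gradNormSq (ψ : M → ℝ) (x : M) : ℝ := ⟪grad (𝓡 3) ψ x, grad (𝓡 3) ψ x⟫_ℝ

theorem isSmoothFunction_gradNormSq {ψ : M → ℝ} (hψ : IsSmoothFunction (𝓡 3) ψ) :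
    IsSmoothFunction (𝓡 3) (gradNormSq ψ) := fun x =>
  contMDiffAt_inner (contMDiff_grad hψ x) (contMDiff_grad hψ x)

theorem mvfderiv_gradNormSq {ψ : M → ℝ} (hψ : IsSmoothFunction (𝓡 3) ψ) (x : M)
    (v : TangentSpace (𝓡 3) x) :
    mvfderiv (𝓡 3) (gradNormSq ψ) x v
      = 2 * ⟪leviCivita (𝓡 3) (grad (𝓡 3) ψ) x v, grad (𝓡 3) ψ x⟫_ℝ := by
  have hN := IsSmoothField.diffAt (contMDiff_grad hψ) x
  have h := mvfderiv_inner hN hN v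
  rw [real_inner_comm (leviCivita (𝓡 3) (grad (𝓡 3) ψ) x v) (grad (𝓡 3) ψ x)] at h
  exact h.trans (two_mul _).symm

/-- If `|grad ψ|²` is a function of `ψ`, it is constant in the directions in which `ψ` is. -/
theorem mvfderiv_gradNormSq_eq_zero {ψ : M → ℝ} (hψ : IsSmoothFunction (𝓡 3) ψ) {F₁ : ℝ → ℝ}
    (hF₁ : ∀ x, gradNormSq ψ x = F₁ (ψ x)) {x : M} {v : TangentSpace (𝓡 3) x}
    (hv : mvfderiv (𝓡 3) ψ x v = 0) : mvfderiv (𝓡 3) (gradNormSq ψ) x v = 0 := by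
  by_cases hN : grad (𝓡 3) ψ x = 0
  · rw [mvfderiv_gradNormSq hψ, hN, inner_zero_right, mul_zero]
  · refine mvfderiv_eq_zero_of_comp hψ (isSmoothFunction_gradNormSq hψ) hF₁ hv
      (w := grad (𝓡 3) ψ x) ?_
    rw [← inner_grad_left]
    exact (inner_self_eq_zero (𝕜 := ℝ)).not.2 hN

namespace SasakianStructure

variable (S : SasakianStructure M)

/-- The rotated gradient `φ (grad ψ)`. -/
def rotGrad (ψ : M → ℝ) (x : M) : TangentSpace (𝓡 3) x := S.φ x (grad (𝓡 3) ψ x)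

variable {ψ : M → ℝ}

theorem isSmoothField_rotGrad (hψ : IsSmoothFunction (𝓡 3) ψ) : IsSmoothField (𝓡 3) (S.rotGrad ψ) :=
  S.contMDiff_φ_apply (contMDiff_grad hψ)

theorem inner_grad_rotGrad (x : M) : ⟪grad (𝓡 3) ψ x, S.rotGrad ψ x⟫_ℝ = 0 :=
  S.inner_φ_self x _

theorem mvfderiv_rotGrad (x : M) : mvfderiv (𝓡 3) ψ x (S.rotGrad ψ x) = 0 := by
  rw [← inner_grad_left, S.inner_grad_rotGrad]

theorem inner_rotGrad_ξ (x : M) : ⟪S.rotGrad ψ x, S.ξ x⟫_ℝ = 0 := S.inner_φ_ξ x _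

theorem inner_grad_ξ (hξψ : ∀ x, mvfderiv (𝓡 3) ψ x (S.ξ x) = 0) (x : M) :
    ⟪grad (𝓡 3) ψ x, S.ξ x⟫_ℝ = 0 := by
  rw [inner_grad_left, hξψ]

theorem inner_rotGrad_self (hξψ : ∀ x, mvfderiv (𝓡 3) ψ x (S.ξ x) = 0) (x : M) :
    ⟪S.rotGrad ψ x, S.rotGrad ψ x⟫_ℝ = gradNormSq ψ x :=
  S.inner_φ_φ (S.inner_grad_ξ hξψ x)

theorem rotGrad_ne_zero (hξψ : ∀ x, mvfderiv (𝓡 3) ψ x (S.ξ x) = 0) {x : M}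
    (hN : grad (𝓡 3) ψ x ≠ 0) : S.rotGrad ψ x ≠ 0 := by
  intro h
  have := S.inner_rotGrad_self hξψ x
  rw [h, inner_zero_left, gradNormSq, eq_comm, inner_self_eq_zero] at this
  exact hN this

theorem rotGrad_eq_zero {x : M} (hN : grad (𝓡 3) ψ x = 0) : S.rotGrad ψ x = 0 := by
  rw [rotGrad, hN, map_zero]

theorem φ_rotGrad (hξψ : ∀ x, mvfderiv (𝓡 3) ψ x (S.ξ x) = 0) (x : M) :
    S.φ x (S.rotGrad ψ x) = -grad (𝓡 3) ψ x :=
  S.φ_φ (S.inner_grad_ξ hξψ x)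

theorem inner_leviCivita_rotGrad_ξ (hψ : IsSmoothFunction (𝓡 3) ψ) (x : M)
    (v : TangentSpace (𝓡 3) x) :
    ⟪leviCivita (𝓡 3) (S.rotGrad ψ) x v, S.ξ x⟫_ℝ = ⟪S.rotGrad ψ x, S.φ x v⟫_ℝ := by
  have h := mvfderiv_inner ((S.isSmoothField_rotGrad hψ).diffAt x) (S.mdifferentiableAt_ξ x) v
  simp only [S.inner_rotGrad_ξ, mvfderiv_const, S.leviCivita_ξ, inner_neg_right, zero_apply] at h
  linarith

theorem inner_leviCivita_rotGrad_grad (hψ : IsSmoothFunction (𝓡 3) ψ) (x : M)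
    (v : TangentSpace (𝓡 3) x) :
    ⟪leviCivita (𝓡 3) (S.rotGrad ψ) x v, grad (𝓡 3) ψ x⟫_ℝ
      = -⟪leviCivita (𝓡 3) (grad (𝓡 3) ψ) x (S.rotGrad ψ x), v⟫_ℝ := by
  have hN := IsSmoothField.diffAt (contMDiff_grad hψ) x
  have h := mvfderiv_inner hN ((S.isSmoothField_rotGrad hψ).diffAt x) v
  simp only [S.inner_grad_rotGrad, mvfderiv_const, zero_apply] at h
  rw [inner_leviCivita_grad_comm (hψ x) hN v,
    real_inner_comm (leviCivita (𝓡 3) (S.rotGrad ψ) x v)] at h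
  linarith

theorem inner_leviCivita_rotGrad_self (hψ : IsSmoothFunction (𝓡 3) ψ)
    (hξψ : ∀ x, mvfderiv (𝓡 3) ψ x (S.ξ x) = 0) (x : M) (v : TangentSpace (𝓡 3) x) :
    2 * ⟪leviCivita (𝓡 3) (S.rotGrad ψ) x v, S.rotGrad ψ x⟫_ℝ
      = mvfderiv (𝓡 3) (gradNormSq ψ) x v := by
  have hT := (S.isSmoothField_rotGrad hψ).diffAt x
  have h := mvfderiv_inner hT hT v
  simp only [S.inner_rotGrad_self hξψ] at h
  rw [real_inner_comm (leviCivita (𝓡 3) (S.rotGrad ψ) x v) (S.rotGrad ψ x)] at h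
  exact (two_mul _).trans h.symm

theorem inner_leviCivita_grad_ξ (hψ : IsSmoothFunction (𝓡 3) ψ)
    (hξψ : ∀ x, mvfderiv (𝓡 3) ψ x (S.ξ x) = 0) (x : M) (v : TangentSpace (𝓡 3) x) :
    ⟪leviCivita (𝓡 3) (grad (𝓡 3) ψ) x v, S.ξ x⟫_ℝ = ⟪grad (𝓡 3) ψ x, S.φ x v⟫_ℝ := by
  have hN := IsSmoothField.diffAt (contMDiff_grad hψ) x
  have h := mvfderiv_inner hN (S.mdifferentiableAt_ξ x) v
  simp only [S.inner_grad_ξ hξψ, mvfderiv_const, S.leviCivita_ξ, inner_neg_right, zero_apply] at h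
  linarith

theorem leviCivita_ξ_rotGrad (hψ : IsSmoothFunction (𝓡 3) ψ)
    (hξψ : ∀ x, mvfderiv (𝓡 3) ψ x (S.ξ x) = 0) {F₁ : ℝ → ℝ}
    (hF₁ : ∀ x, gradNormSq ψ x = F₁ (ψ x)) (x : M) :
    leviCivita (𝓡 3) (S.rotGrad ψ) x (S.ξ x) = grad (𝓡 3) ψ x := by
  have hHess (v w : TangentSpace (𝓡 3) x) := inner_leviCivita_grad_comm (hψ x)
    (IsSmoothField.diffAt (contMDiff_grad hψ) x) v w
  by_cases hN : grad (𝓡 3) ψ x = 0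
  · have h0 : leviCivita (𝓡 3) (grad (𝓡 3) ψ) x (S.ξ x) = 0 := by
      refine ext_inner_right ℝ fun w => ?_
      rw [hHess, S.inner_leviCivita_grad_ξ hψ hξψ, hN, inner_zero_left, inner_zero_left]
    rw [hN]
    exact (S.leviCivita_φ_of_eq_zero (contMDiff_grad hψ) hN _).trans (by rw [h0, map_zero])
  · refine ext_of_orthogonal (finrank_tangentSpace x) (S.inner_grad_rotGrad x)
      (S.inner_grad_ξ hξψ x) (S.inner_rotGrad_ξ x) hN (S.rotGrad_ne_zero hξψ hN) (S.ξ_ne_zero x)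
      ?_ ?_ ?_
    · rw [S.inner_leviCivita_rotGrad_grad hψ, S.inner_leviCivita_grad_ξ hψ hξψ,
        S.φ_rotGrad hξψ, inner_neg_right, neg_neg]
    · have h := S.inner_leviCivita_rotGrad_self hψ hξψ x (S.ξ x)
      rw [mvfderiv_gradNormSq_eq_zero hψ hF₁ (hξψ x)] at h
      rw [S.inner_grad_rotGrad]
      linarith
    · rw [S.inner_leviCivita_rotGrad_ξ hψ, S.φ_ξ, inner_zero_right, S.inner_grad_ξ hξψ]

theorem divergence_rotGrad (hψ : IsSmoothFunction (𝓡 3) ψ)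
    (hξψ : ∀ x, mvfderiv (𝓡 3) ψ x (S.ξ x) = 0) {F₁ : ℝ → ℝ}
    (hF₁ : ∀ x, gradNormSq ψ x = F₁ (ψ x)) (x : M) :
    divergence (𝓡 3) (S.rotGrad ψ) x = 0 := by
  have hT0 := mvfderiv_gradNormSq_eq_zero hψ hF₁ (S.mvfderiv_rotGrad (ψ := ψ) x)
  by_cases hN : grad (𝓡 3) ψ x = 0
  · have h : (leviCivita (𝓡 3) (S.rotGrad ψ) x).toLinearMap
        = (S.φ x).toLinearMap ∘ₗ (leviCivita (𝓡 3) (grad (𝓡 3) ψ) x).toLinearMap :=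
      LinearMap.ext fun v => S.leviCivita_φ_of_eq_zero (contMDiff_grad hψ) hN v
    rw [divergence, h]
    exact trace_comp_eq_zero_of_skew_of_symmetric _ _ (fun v w => S.inner_φ_left x v w)
      fun v w => inner_leviCivita_grad_comm (hψ x)
        (IsSmoothField.diffAt (contMDiff_grad hψ) x) v w
  · rw [divergence, trace_eq_of_orthogonal (finrank_tangentSpace x) (S.inner_grad_rotGrad x)
      (S.inner_grad_ξ hξψ x) (S.inner_rotGrad_ξ x) hN (S.rotGrad_ne_zero hξψ hN) (S.ξ_ne_zero x)]
    have h1 := S.inner_leviCivita_rotGrad_grad hψ x (grad (𝓡 3) ψ x)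
    have h2 := S.inner_leviCivita_rotGrad_self hψ hξψ x (S.rotGrad ψ x)
    have h3 := S.inner_leviCivita_rotGrad_ξ hψ x (S.ξ x)
    rw [mvfderiv_gradNormSq hψ] at hT0
    rw [mvfderiv_gradNormSq hψ, hT0] at h2
    rw [S.φ_ξ, inner_zero_right] at h3
    have h1' : ⟪leviCivita (𝓡 3) (S.rotGrad ψ) x (grad (𝓡 3) ψ x), grad (𝓡 3) ψ x⟫_ℝ = 0 := by
      linarith
    have h2' : ⟪leviCivita (𝓡 3) (S.rotGrad ψ) x (S.rotGrad ψ x), S.rotGrad ψ x⟫_ℝ = 0 := by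
      linarith
    simp only [ContinuousLinearMap.coe_coe]
    rw [h1', h2', h3]
    simp

/-- The acceleration of the rotated gradient. -/
theorem leviCivita_rotGrad_rotGrad (hψ : IsSmoothFunction (𝓡 3) ψ)
    (hξψ : ∀ x, mvfderiv (𝓡 3) ψ x (S.ξ x) = 0) {F₁ : ℝ → ℝ}
    (hF₁ : ∀ x, gradNormSq ψ x = F₁ (ψ x)) (x : M) :
    leviCivita (𝓡 3) (S.rotGrad ψ) x (S.rotGrad ψ x)
      = laplacian (𝓡 3) ψ x • grad (𝓡 3) ψ x
        + (1 / 2 : ℝ) • grad (𝓡 3) (gradNormSq ψ) x := by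
  by_cases hN : grad (𝓡 3) ψ x = 0
  · have h0 : grad (𝓡 3) (gradNormSq ψ) x = 0 := by
      refine ext_inner_right ℝ fun v => ?_
      rw [inner_grad_left, mvfderiv_gradNormSq hψ, hN, inner_zero_right, inner_zero_left, mul_zero]
    rw [S.rotGrad_eq_zero hN, hN, h0]
    simp
  · refine ext_of_orthogonal (finrank_tangentSpace x) (S.inner_grad_rotGrad x)
      (S.inner_grad_ξ hξψ x) (S.inner_rotGrad_ξ x) hN (S.rotGrad_ne_zero hξψ hN) (S.ξ_ne_zero x)
      ?_ ?_ ?_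
    · have hdiv := trace_eq_of_orthogonal (finrank_tangentSpace x) (S.inner_grad_rotGrad x)
        (S.inner_grad_ξ hξψ x) (S.inner_rotGrad_ξ x) hN (S.rotGrad_ne_zero hξψ hN) (S.ξ_ne_zero x)
        (leviCivita (𝓡 3) (grad (𝓡 3) ψ) x).toLinearMap
      simp only [ContinuousLinearMap.coe_coe] at hdiv
      rw [S.inner_leviCivita_grad_ξ hψ hξψ, S.φ_ξ, inner_zero_right, zero_div, add_zero,
        S.inner_rotGrad_self hξψ] at hdiv
      change divergence (𝓡 3) (grad (𝓡 3) ψ) x = _ / gradNormSq ψ x + _ at hdiv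
      have hne : gradNormSq ψ x ≠ 0 := (inner_self_eq_zero (𝕜 := ℝ)).not.2 hN
      rw [S.inner_leviCivita_rotGrad_grad hψ, inner_add_left, real_inner_smul_left,
        real_inner_smul_left, inner_grad_left (gradNormSq ψ), mvfderiv_gradNormSq hψ, laplacian,
        hdiv]
      change _ = -_ * gradNormSq ψ x + _
      field_simp
      ring
    · have h := S.inner_leviCivita_rotGrad_self hψ hξψ x (S.rotGrad ψ x)
      rw [inner_add_left, real_inner_smul_left, real_inner_smul_left, S.inner_grad_rotGrad,
        inner_grad_left, ← h]
      ring
    · rw [S.inner_leviCivita_rotGrad_ξ hψ, S.inner_φ_self, inner_add_left, real_inner_smul_left,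
        real_inner_smul_left, S.inner_grad_ξ hξψ, inner_grad_left,
        mvfderiv_gradNormSq_eq_zero hψ hF₁ (hξψ x)]
      simp

end SasakianStructure

end InvariantFunction

section EulerField

variable {M : Type*} [TopologicalSpace M]
  [ChartedSpace (EuclideanSpace ℝ (Fin 3)) M] [IsManifold (𝓡 3) ∞ M]
  [RiemannianBundle (fun x : M => TangentSpace (𝓡 3) x)]
  [IsContMDiffRiemannianBundle (𝓡 3) ∞ (EuclideanSpace ℝ (Fin 3))
    (fun x : M => TangentSpace (𝓡 3) x)]

theorem mvfderiv_mul_apply {f g : M → ℝ} (hf : IsSmoothFunction (𝓡 3) f)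
    (hg : IsSmoothFunction (𝓡 3) g) (x : M) (v : TangentSpace (𝓡 3) x) :
    mvfderiv (𝓡 3) (fun y => f y * g y) x v
      = f x * mvfderiv (𝓡 3) g x v + g x * mvfderiv (𝓡 3) f x v := by
  rw [mvfderiv_fun_mul (hf.diffAt x) (hg.diffAt x)]
  rfl

namespace SasakianStructure

variable (S : SasakianStructure M) {ψ f g : M → ℝ}

theorem isSmoothField_combination (hψ : IsSmoothFunction (𝓡 3) ψ)
    (hf : IsSmoothFunction (𝓡 3) f) (hg : IsSmoothFunction (𝓡 3) g) :
    IsSmoothField (𝓡 3) (f • S.ξ + g • S.rotGrad ψ) := fun x =>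
  ((hf x).smul_section (S.killing.1 x)).add_section
    ((hg x).smul_section (S.isSmoothField_rotGrad hψ x))

theorem divergence_combination (hψ : IsSmoothFunction (𝓡 3) ψ)
    (hf : IsSmoothFunction (𝓡 3) f) (hg : IsSmoothFunction (𝓡 3) g)
    (hξψ : ∀ x, mvfderiv (𝓡 3) ψ x (S.ξ x) = 0) {F₁ : ℝ → ℝ}
    (hF₁ : ∀ x, gradNormSq ψ x = F₁ (ψ x)) {x : M} (hfξ : mvfderiv (𝓡 3) f x (S.ξ x) = 0)
    (hgT : mvfderiv (𝓡 3) g x (S.rotGrad ψ x) = 0) :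
    divergence (𝓡 3) (f • S.ξ + g • S.rotGrad ψ) x = 0 := by
  rw [divergence_add (((hf x).smul_section (S.killing.1 x)).mdifferentiableAt (by simp))
      (((hg x).smul_section (S.isSmoothField_rotGrad hψ x)).mdifferentiableAt (by simp)),
    divergence_smul (hf.diffAt x) (S.mdifferentiableAt_ξ x),
    divergence_smul (hg.diffAt x) ((S.isSmoothField_rotGrad hψ).diffAt x), S.divergence_ξ,
    S.divergence_rotGrad hψ hξψ hF₁, hfξ, hgT]
  simp

/-- The acceleration of a combination of the Reeb field and the rotated gradient with coefficients
that are constant along it. -/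
theorem leviCivita_combination (hψ : IsSmoothFunction (𝓡 3) ψ)
    (hf : IsSmoothFunction (𝓡 3) f) (hg : IsSmoothFunction (𝓡 3) g)
    (hξψ : ∀ x, mvfderiv (𝓡 3) ψ x (S.ξ x) = 0) {F₁ : ℝ → ℝ}
    (hF₁ : ∀ x, gradNormSq ψ x = F₁ (ψ x)) {x : M}
    (hfu : mvfderiv (𝓡 3) f x ((f • S.ξ + g • S.rotGrad ψ) x) = 0)
    (hgu : mvfderiv (𝓡 3) g x ((f • S.ξ + g • S.rotGrad ψ) x) = 0) :
    leviCivita (𝓡 3) (f • S.ξ + g • S.rotGrad ψ) x ((f • S.ξ + g • S.rotGrad ψ) x)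
      = (2 * f x * g x + g x ^ 2 * laplacian (𝓡 3) ψ x) • grad (𝓡 3) ψ x
        + (g x ^ 2 / 2) • grad (𝓡 3) (gradNormSq ψ) x := by
  rw [leviCivita_add (((hf x).smul_section (S.killing.1 x)).mdifferentiableAt (by simp))
      (((hg x).smul_section (S.isSmoothField_rotGrad hψ x)).mdifferentiableAt (by simp)),
    leviCivita_smul (hf.diffAt x) (S.mdifferentiableAt_ξ x),
    leviCivita_smul (hg.diffAt x) ((S.isSmoothField_rotGrad hψ).diffAt x), hfu, hgu,
    S.leviCivita_ξ]
  simp only [Pi.add_apply, Pi.smul_apply', map_add, map_smul, S.φ_ξ, S.φ_rotGrad hξψ,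
    S.leviCivita_ξ_rotGrad hψ hξψ hF₁, S.leviCivita_rotGrad_rotGrad hψ hξψ hF₁]
  module

theorem mvfderiv_combination (hξψ : ∀ x, mvfderiv (𝓡 3) ψ x (S.ξ x) = 0) (x : M) :
    mvfderiv (𝓡 3) ψ x ((f • S.ξ + g • S.rotGrad ψ) x) = 0 := by
  simp [hξψ, S.mvfderiv_rotGrad]

theorem isLocalizable_combination (hψ : IsIsoparametric (𝓡 3) ψ)
    (hξψ : ∀ x, mvfderiv (𝓡 3) ψ x (S.ξ x) = 0)
    {F g : ℝ → ℝ} (hF : ContDiff ℝ ∞ F) (hg : ContDiff ℝ ∞ g) :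
    IsLocalizable (𝓡 3) ((fun x => F (ψ x)) • S.ξ + (fun x => g (ψ x)) • S.rotGrad ψ) := by
  obtain ⟨hψ, F₁, F₂, hF₁₂⟩ := hψ
  have hF₁ (x : M) : gradNormSq ψ x = F₁ (ψ x) := (hF₁₂ x).1
  have hf : IsSmoothFunction (𝓡 3) (fun x => F (ψ x)) := .comp_left hF hψ
  have hgψ : IsSmoothFunction (𝓡 3) (fun x => g (ψ x)) := .comp_left hg hψ
  have hg' : ContDiff ℝ ∞ (deriv g) := (contDiff_infty_iff_deriv.1 hg).2
  have hg'ψ : IsSmoothFunction (𝓡 3) (fun x => deriv g (ψ x)) := .comp_left hg' hψ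
  have hdF (x : M) (v : TangentSpace (𝓡 3) x) :=
    mvfderiv_comp_left (hF.differentiable (by simp) (ψ x)) (hψ.mdifferentiable (by simp) x) v
  have hdg (x : M) (v : TangentSpace (𝓡 3) x) :=
    mvfderiv_comp_left (hg.differentiable (by simp) (ψ x)) (hψ.mdifferentiable (by simp) x) v
  have hν := isSmoothFunction_gradNormSq hψ
  have hL : IsSmoothFunction (𝓡 3) (laplacian (𝓡 3) ψ) := fun x =>
    (contMDiff_divergence (contMDiff_grad hψ) x).neg
  let a : M → ℝ := fun x => 2 * F (ψ x) * g (ψ x) + g (ψ x) ^ 2 * laplacian (𝓡 3) ψ x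
    - g (ψ x) * deriv g (ψ x) * gradNormSq ψ x
  have ha : IsSmoothFunction (𝓡 3) a := fun x =>
    (((contMDiffAt_const.mul (hf x)).mul (hgψ x)).add (((hgψ x).pow 2).mul (hL x))).sub
      (((hgψ x).mul (hg'ψ x)).mul (hν x))
  let A : ℝ → ℝ := fun t => 2 * F t * g t + g t ^ 2 * F₂ t - g t * deriv g t * F₁ t
  have hcomp (x : M) : a x = A (ψ x) := by
    simp only [a, A, hF₁, (hF₁₂ x).2]
  have : LocallyPathConnectedSpace M :=
    ChartedSpace.locallyPathConnectedSpace (EuclideanSpace ℝ (Fin 3)) M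
  obtain ⟨h, hh⟩ := exists_primitive hψ.continuous ha.continuous hcomp
  obtain ⟨hhs, hdh⟩ := contMDiff_of_isLittleO hψ ha hh
  let p : M → ℝ := fun x => -(1 / 2 * (g (ψ x) * g (ψ x) * gradNormSq ψ x) + h x)
  have hg2 : IsSmoothFunction (𝓡 3) (fun x => g (ψ x) * g (ψ x)) := fun x => (hgψ x).mul (hgψ x)
  have hg2ν : IsSmoothFunction (𝓡 3) (fun x => g (ψ x) * g (ψ x) * gradNormSq ψ x) :=
    fun x => (hg2 x).mul (hν x)
  have hhalf : IsSmoothFunction (𝓡 3) (fun x => 1 / 2 * (g (ψ x) * g (ψ x) * gradNormSq ψ x)) :=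
    fun x => contMDiffAt_const.mul (hg2ν x)
  have hu := S.isSmoothField_combination hψ hf hgψ
  have hdFu (x : M) : mvfderiv (𝓡 3) (fun y => F (ψ y)) x
      (((fun x => F (ψ x)) • S.ξ + (fun x => g (ψ x)) • S.rotGrad ψ) x) = 0 := by
    rw [hdF, S.mvfderiv_combination hξψ, mul_zero]
  have hdgu (x : M) : mvfderiv (𝓡 3) (fun y => g (ψ y)) x
      (((fun x => F (ψ x)) • S.ξ + (fun x => g (ψ x)) • S.rotGrad ψ) x) = 0 := by
    rw [hdg, S.mvfderiv_combination hξψ, mul_zero]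
  refine ⟨⟨hu, ⟨p, fun x => ((hhalf x).add (hhs x)).neg, fun x => ?_⟩, fun x => ?_⟩, fun x => ?_⟩
  · rw [S.leviCivita_combination hψ hf hgψ hξψ hF₁ (hdFu x) (hdgu x)]
    refine ext_inner_right ℝ fun v => ?_
    have hp : mvfderiv (𝓡 3) p x v
        = -(1 / 2 * (g (ψ x) * g (ψ x) * mvfderiv (𝓡 3) (gradNormSq ψ) x v
          + gradNormSq ψ x * (2 * g (ψ x) * (deriv g (ψ x) * mvfderiv (𝓡 3) ψ x v)))
          + a x * mvfderiv (𝓡 3) ψ x v) := by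
      rw [mvfderiv_fun_neg, mvfderiv_fun_add (hhalf.diffAt x) (hhs.mdifferentiable (by simp) x)]
      simp only [neg_apply, add_apply, hdh]
      rw [mvfderiv_mul_apply (f := fun _ => 1 / 2) (fun x => contMDiffAt_const) hg2ν,
        mvfderiv_mul_apply hg2 hν, mvfderiv_mul_apply hgψ hgψ, hdg, mvfderiv_const]
      simp only [zero_apply, smul_apply, smul_eq_mul]
      ring
    rw [inner_neg_left, inner_add_left, real_inner_smul_left, real_inner_smul_left,
      inner_grad_left, inner_grad_left, inner_grad_left, hp]
    simp only [a]
    ring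
  · exact S.divergence_combination hψ hf hgψ hξψ hF₁ (by rw [hdF, hξψ, mul_zero])
      (by rw [hdg, S.mvfderiv_rotGrad, mul_zero])
  · have hux := hu.diffAt x
    rw [mvfderiv_inner hux hux, S.leviCivita_combination hψ hf hgψ hξψ hF₁ (hdFu x) (hdgu x)]
    have h1 := S.mvfderiv_combination (f := fun x => F (ψ x)) (g := fun x => g (ψ x)) hξψ x
    have h2 := mvfderiv_gradNormSq_eq_zero hψ hF₁ h1
    rw [inner_add_left, inner_add_right, real_inner_smul_left, real_inner_smul_left,
      real_inner_smul_right, real_inner_smul_right, inner_grad_left, inner_grad_left,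
      inner_grad_right, inner_grad_right, h1, h2]
    simp

end SasakianStructure

end EulerField

end SasakianEuler

end

theorem mainTheorem5 {M : Type*} [TopologicalSpace M] [T2Space M] [SecondCountableTopology M]
    [ChartedSpace (EuclideanSpace ℝ (Fin 3)) M] [IsManifold (𝓡 3) ∞ M]
    [RiemannianBundle (fun x : M => TangentSpace (𝓡 3) x)]
    [IsContMDiffRiemannianBundle (𝓡 3) ∞ (EuclideanSpace ℝ (Fin 3))
      (fun x : M => TangentSpace (𝓡 3) x)]
    (S : SasakianEuler.SasakianStructure M)
    (ψ : M → ℝ) (hψ : SasakianEuler.IsIsoparametric (𝓡 3) ψ)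
    (hξψ : ∀ x, mvfderiv (𝓡 3) ψ x (S.ξ x) = 0)
    (F G : ℝ → ℝ) (hF : ContDiff ℝ ∞ F) (hG : ContDiff ℝ ∞ G) :
    SasakianEuler.IsLocalizable (𝓡 3)
      (fun x => F (ψ x) • S.ξ x + S.φ x (SasakianEuler.grad (𝓡 3) (fun y => G (ψ y)) x)) := by
  have h := S.isLocalizable_combination hψ hξψ hF (contDiff_infty_iff_deriv.1 hG).2
  convert h using 1
  funext x
  rw [SasakianEuler.grad_comp (hG.differentiable (by simp) (ψ x))
    (hψ.1.mdifferentiable (by simp) x), map_smul]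
  rfl
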